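/- All graphs are finite and simple. A proper coloring $\varphi\colon V(G)\to\{1,\dots,k\}$ is a *b-coloring of $G$ with $k$ colors* if for every color $i$ there is a vertex $x$ with $\varphi(x)=i$ that has, for each color $j\ne i$, a neighbor of color $j$. Let $\Delta(G)$ be the maximum degree of $G$, and let $m(G)$ be the largest integer $i$ such that $G$ has at least $i$ vertices of degree at least $i-1$. **Theorem.** There is an algorithm that, given a graph $G$ on $n$ vertices, decides whether $G$ has a b-coloring with $k=m(G)$ colors in time $$2^{O(k^4\cdot\Delta(G))}+n^{O(1)},$$ and hence in time $2^{O(\Delta(G)^5)}+n^{O(1)}$. In particular, the problem is fixed-parameter tractable parameterized by $\Delta(G)$: it can be decided in time $f(\Delta(G))\cdot|G|^{c}$ for some computable function $f$ and some constant $c$, where $|G|$ is the size of the input. Here an algorithm is a single program of a random-access machine with unit-cost addition, truncated subtraction, comparison and indirect addressing, whose input is $n$ together with the adjacency matrix of $G$; the constants hidden in $O(\cdot)$ are absolute, and $n^{O(1)}$ stands for a bound $c\,(n^{c}+1)$ with a constant $c$. -/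

import Mathlib

namespace BCol

/-! ### b-colorings and the m-degree -/

/-- A proper coloring with the colors `Fin k` is a b-coloring if every color `i` has a
b-vertex: a vertex of color `i` with a neighbor of every other color. -/
def IsBColoring {V : Type*} {G : SimpleGraph V} {k : ℕ} (φ : G.Coloring (Fin k)) : Prop :=
  ∀ i : Fin k, ∃ x : V, φ x = i ∧ ∀ j : Fin k, j ≠ i → ∃ y : V, G.Adj x y ∧ φ y = j

/-- `G` has a b-coloring with `k` colors. -/
def HasBColoring {V : Type*} (G : SimpleGraph V) (k : ℕ) : Prop :=
  ∃ φ : G.Coloring (Fin k), IsBColoring φ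

open Classical in
/-- The number of vertices of degree at least `i - 1`
(written `i ≤ degree + 1`, to avoid truncated subtraction). -/
noncomputable def numDegGe {V : Type*} [Fintype V] (G : SimpleGraph V) (i : ℕ) : ℕ :=
  (Finset.univ.filter fun v : V => i ≤ G.degree v + 1).card

/-- The m-degree `m(G)`: the largest `i` such that `G` has (at least) `i` vertices of degree at
least `i - 1`. -/
noncomputable def mDegree {V : Type*} [Fintype V] (G : SimpleGraph V) : ℕ :=
  sSup {i : ℕ | i ≤ numDegGe G i}

/-- The supremum in the definition of the m-degree is a maximum. -/
theorem isGreatest_mDegree {V : Type*} [Fintype V] (G : SimpleGraph V) :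
    IsGreatest {i : ℕ | i ≤ numDegGe G i} (mDegree G) := by
  have hb : BddAbove {i : ℕ | i ≤ numDegGe G i} :=
    ⟨Fintype.card V, fun i hi => le_trans hi (Finset.card_le_univ _)⟩
  exact ⟨Nat.sSup_mem ⟨0, Nat.zero_le _⟩ hb, fun i hi => le_csSup hb hi⟩

open Classical in
/-- The maximum degree `Δ(G)` (it is `0` for the graph without vertices). -/
noncomputable def maxDeg {V : Type*} [Fintype V] (G : SimpleGraph V) : ℕ :=
  G.maxDegree

/-! ### Random-access machines -/

/-- Memory of a random-access machine: registers `reg x` and unbounded arrays `arr a`, with cells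
`arr a i`, all holding natural numbers. A program mentions only finitely many registers and
arrays. -/
structure State where
  reg : ℕ → ℕ
  arr : ℕ → ℕ → ℕ

/-- Write the value `v` into register `x`. -/
def State.setReg (s : State) (x v : ℕ) : State :=
  { s with reg := Function.update s.reg x v }

/-- Write the value `v` into cell `i` of array `a`. -/
def State.setArr (s : State) (a i v : ℕ) : State :=
  { s with arr := Function.update s.arr a (Function.update (s.arr a) i v) }

/-- Programs of a random-access machine, with structured control flow. Register names, array names
and constants are fixed by the program; only array indices are computed (indirect addressing).
The arithmetic consists of addition and truncated subtraction, so that unit cost is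
polynomially equivalent to time on Turing machines. -/
inductive Prog where
  /-- do nothing -/
  | skip : Prog
  /-- `x := c` for a constant `c` -/
  | const (x c : ℕ) : Prog
  /-- `x := y + z` -/
  | add (x y z : ℕ) : Prog
  /-- `x := y - z` (truncated) -/
  | sub (x y z : ℕ) : Prog
  /-- `x := a[y]` -/
  | load (x a y : ℕ) : Prog
  /-- `a[x] := y` -/
  | store (a x y : ℕ) : Prog
  /-- `p ; q` -/
  | seq (p q : Prog) : Prog
  /-- `if x < y then p else q` -/
  | ite (x y : ℕ) (p q : Prog) : Prog
  /-- `while x < y do p` -/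
  | loop (x y : ℕ) (p : Prog) : Prog

/-- `Runs p s t s'`: program `p`, started in memory `s`, halts after exactly `t` steps in
memory `s'`. Every elementary instruction and every evaluation of a test is one step. -/
inductive Runs : Prog → State → ℕ → State → Prop where
  | skip (s : State) : Runs .skip s 1 s
  | const (x c : ℕ) (s : State) : Runs (.const x c) s 1 (s.setReg x c)
  | add (x y z : ℕ) (s : State) : Runs (.add x y z) s 1 (s.setReg x (s.reg y + s.reg z))
  | sub (x y z : ℕ) (s : State) : Runs (.sub x y z) s 1 (s.setReg x (s.reg y - s.reg z))
  | load (x a y : ℕ) (s : State) : Runs (.load x a y) s 1 (s.setReg x (s.arr a (s.reg y)))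
  | store (a x y : ℕ) (s : State) : Runs (.store a x y) s 1 (s.setArr a (s.reg x) (s.reg y))
  | seq {p q : Prog} {s s' s'' : State} {t t' : ℕ} :
      Runs p s t s' → Runs q s' t' s'' → Runs (.seq p q) s (t + t') s''
  | ite_true {x y : ℕ} {p q : Prog} {s s' : State} {t : ℕ} :
      s.reg x < s.reg y → Runs p s t s' → Runs (.ite x y p q) s (t + 1) s'
  | ite_false {x y : ℕ} {p q : Prog} {s s' : State} {t : ℕ} :
      ¬ s.reg x < s.reg y → Runs q s t s' → Runs (.ite x y p q) s (t + 1) s'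
  | loop_done {x y : ℕ} {p : Prog} {s : State} :
      ¬ s.reg x < s.reg y → Runs (.loop x y p) s 1 s
  | loop_step {x y : ℕ} {p : Prog} {s s' s'' : State} {t t' : ℕ} :
      s.reg x < s.reg y → Runs p s t s' → Runs (.loop x y p) s' t' s'' →
      Runs (.loop x y p) s (t + t' + 1) s''

open Classical in
/-- The initial memory on input a graph `G` with vertex set `{0, …, n - 1}`: register `0` holds `n`,
array `0` holds the adjacency matrix row by row, and everything else is zero. -/
noncomputable def inputState {n : ℕ} (G : SimpleGraph (Fin n)) : State where
  reg x := if x = 0 then n else 0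
  arr a i := if a = 0 ∧ ∃ u v : Fin n, i = (u : ℕ) * n + (v : ℕ) ∧ G.Adj u v then 1 else 0

/-- The number of memory cells that the input occupies: the adjacency matrix and `n`. -/
def inputSize {n : ℕ} (_G : SimpleGraph (Fin n)) : ℕ := n ^ 2 + 1

/-- On every input graph `G`, the program `p` halts after at most `T G` steps, with the answer to
the question whether `Q G` holds (`1` for yes, `0` for no) in register `0`. -/
def DecidesInTime (p : Prog) (Q : ∀ {n : ℕ}, SimpleGraph (Fin n) → Prop)
    (T : ∀ {n : ℕ}, SimpleGraph (Fin n) → ℕ) : Prop :=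
  ∀ (n : ℕ) (G : SimpleGraph (Fin n)), ∃ (t : ℕ) (s : State),
    Runs p (inputState G) t s ∧ t ≤ T G ∧ (Q G → s.reg 0 = 1) ∧ (¬ Q G → s.reg 0 = 0)

/-- The graph problem `Q`, parameterized by `κ`, is fixed-parameter tractable: it is decided in
time `f(κ(G)) · |G| ^ c` for a computable function `f` and a constant `c`, where `|G|` is the
size of the input. -/
def IsFPT (Q : ∀ {n : ℕ}, SimpleGraph (Fin n) → Prop)
    (κ : ∀ {n : ℕ}, SimpleGraph (Fin n) → ℕ) : Prop :=
  ∃ (p : Prog) (f : ℕ → ℕ) (c : ℕ), Computable f ∧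
    DecidesInTime p Q (fun G => f (κ G) * inputSize G ^ c)

end BCol

/-!
Write `k = m(G)` and `Δ = Δ(G)`. At most `k` vertices have degree at least `k`, and `k ≤ Δ + 1`. A
proper coloring of a set of vertices that contains all vertices of degree at least `k` extends
greedily to all of `G`.

If at least `2 (Δ + 1) ^ 4` vertices have degree at least `k - 1`, a b-coloring exists: after
removal of the balls of radius `2` around the vertices of degree at least `k` there remain `k`
vertices of degree exactly `k - 1` with pairwise distance more than `3`. Give distinct colors to
the vertices in the closed neighborhood of each of them, with color `i` in the `i`-th center, give
distinct colors to the vertices of degree at least `k`, and extend.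

Otherwise all b-vertices and their neighbors are among at most `2 (Δ + 1) ^ 5` candidates. A
b-coloring exists if and only if it can be read off from a precoloring of `2 k ^ 2` not necessarily
distinct candidates, at most `2 k` per color: the b-vertices, a neighbor of each other color for
each of them, and the vertices of degree at least `k`. The numbers below
`2 ^ (12 (Δ + 1) k ^ 2)` encode all such precolorings, and each can be tested in polynomial time.
-/

namespace BCol

open Polynomial

/-! ### Polynomial bounds -/

theorem mul_pow_add_one_le {a b n m : ℕ} (hab : 2 * a ≤ b) (hnm : n ≤ m) (N : ℕ) :
    a * (N ^ n + 1) ≤ b * (N ^ m + 1) := by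
  have hpow : N ^ n ≤ N ^ m + 1 := by
    rcases N.eq_zero_or_pos with rfl | hN
    · exact (pow_le_one₀ le_rfl zero_le_one).trans (Nat.le_add_left 1 _)
    · exact (Nat.pow_le_pow_right hN hnm).trans (Nat.le_succ _)
  calc a * (N ^ n + 1) ≤ a * (2 * (N ^ m + 1)) := by gcongr; omega
    _ = 2 * a * (N ^ m + 1) := by ring
    _ ≤ b * (N ^ m + 1) := by gcongr

theorem exists_eval_le_mul_pow_add_one (q : ℕ[X]) :
    ∃ c : ℕ, ∀ N : ℕ, q.eval N ≤ c * (N ^ c + 1) := by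
  induction q using Polynomial.induction_on' with
  | add p q hp hq =>
    obtain ⟨a, ha⟩ := hp
    obtain ⟨b, hb⟩ := hq
    refine ⟨2 * a + 2 * b, fun N => ?_⟩
    rw [eval_add, add_mul]
    exact add_le_add ((ha N).trans (mul_pow_add_one_le le_rfl (by omega) N))
      ((hb N).trans (mul_pow_add_one_le le_rfl (by omega) N))
  | monomial n c =>
    refine ⟨2 * c + n, fun N => ?_⟩
    rw [eval_monomial]
    exact (Nat.mul_le_mul_left c (Nat.le_succ _)).trans
      (mul_pow_add_one_le (by omega) (by omega) N)

end BCol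

namespace BCol

/-! ### Timed total correctness -/

@[simp]
theorem State.reg_setReg (s : State) (x v i : ℕ) :
    (s.setReg x v).reg i = if i = x then v else s.reg i :=
  Function.update_apply s.reg x v i

/-- Total correctness with a time bound: started in `s`, the program `p` halts after at most `T`
steps in a memory that satisfies `Q`. -/
def HaltsWithin (p : Prog) (s : State) (T : ℕ) (Q : State → Prop) : Prop :=
  ∃ (t : ℕ) (s' : State), Runs p s t s' ∧ t ≤ T ∧ Q s'

namespace HaltsWithin

variable {p q : Prog} {s : State} {T T' : ℕ} {Q Q' : State → Prop}

theorem mono (h : HaltsWithin p s T Q) (hT : T ≤ T') (hQ : ∀ s', Q s' → Q' s') :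
    HaltsWithin p s T' Q' := by
  obtain ⟨t, s', hrun, ht, hs'⟩ := h
  exact ⟨t, s', hrun, ht.trans hT, hQ s' hs'⟩

theorem const {x c : ℕ} (h : Q (s.setReg x c)) : HaltsWithin (.const x c) s 1 Q :=
  ⟨1, _, .const x c s, le_rfl, h⟩

theorem add {x y z : ℕ} (h : Q (s.setReg x (s.reg y + s.reg z))) :
    HaltsWithin (.add x y z) s 1 Q :=
  ⟨1, _, .add x y z s, le_rfl, h⟩

theorem sub {x y z : ℕ} (h : Q (s.setReg x (s.reg y - s.reg z))) :
    HaltsWithin (.sub x y z) s 1 Q :=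
  ⟨1, _, .sub x y z s, le_rfl, h⟩

theorem load {x a y : ℕ} (h : Q (s.setReg x (s.arr a (s.reg y)))) :
    HaltsWithin (.load x a y) s 1 Q :=
  ⟨1, _, .load x a y s, le_rfl, h⟩

theorem seq (h : HaltsWithin p s T fun s' => HaltsWithin q s' T' Q) :
    HaltsWithin (.seq p q) s (T + T') Q := by
  obtain ⟨t, s', hp, ht, t', s'', hq, ht', hQ⟩ := h
  exact ⟨t + t', s'', hp.seq hq, add_le_add ht ht', hQ⟩

theorem ite {x y : ℕ} (hp : s.reg x < s.reg y → HaltsWithin p s T Q)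
    (hq : ¬ s.reg x < s.reg y → HaltsWithin q s T Q) :
    HaltsWithin (.ite x y p q) s (T + 1) Q := by
  by_cases hxy : s.reg x < s.reg y
  · obtain ⟨t, s', hrun, ht, hQ⟩ := hp hxy
    exact ⟨t + 1, s', .ite_true hxy hrun, Nat.succ_le_succ ht, hQ⟩
  · obtain ⟨t, s', hrun, ht, hQ⟩ := hq hxy
    exact ⟨t + 1, s', .ite_false hxy hrun, Nat.succ_le_succ ht, hQ⟩

theorem countedLoop {x y m : ℕ} (I : ℕ → State → Prop)
    (hx : ∀ i s, I i s → s.reg x = i) (hy : ∀ i s, I i s → s.reg y = m)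
    (hbody : ∀ i < m, ∀ s, I i s → HaltsWithin p s T (I (i + 1))) (h₀ : I 0 s) :
    HaltsWithin (.loop x y p) s (m * (T + 1) + 1) (I m) := by
  suffices hrest : ∀ r i s, i + r = m → I i s →
      HaltsWithin (.loop x y p) s (r * (T + 1) + 1) (I m) from hrest m 0 s (zero_add m) h₀
  intro r
  induction r with
  | zero =>
    intro i s hi hI
    obtain rfl : i = m := hi
    exact ⟨1, s, .loop_done (by rw [hx i s hI, hy i s hI]; exact lt_irrefl i), by simp, hI⟩
  | succ r ih =>
    intro i s hi hI
    obtain ⟨t, s', hrun, ht, hI'⟩ := hbody i (by omega) s hI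
    obtain ⟨t', s'', hrun', ht', hI''⟩ := ih (i + 1) s' (by omega) hI'
    refine ⟨t + t' + 1, s'', .loop_step ?_ hrun hrun', ?_, hI''⟩
    · rw [hx i s hI, hy i s hI]
      omega
    · rw [Nat.succ_mul]
      omega

end HaltsWithin

/-- The memory `s'` has the same arrays and the same registers below `d` as `s`: what is kept by a
program that uses the registers from `d` on as work space. -/
def AgreeBelow (d : ℕ) (s s' : State) : Prop :=
  s'.arr = s.arr ∧ ∀ i < d, s'.reg i = s.reg i

namespace AgreeBelow

variable {d d' x v : ℕ} {s s' s'' : State}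

theorem refl (d : ℕ) (s : State) : AgreeBelow d s s :=
  ⟨rfl, fun _ _ => rfl⟩

theorem trans (h : AgreeBelow d s s') (h' : AgreeBelow d s' s'') : AgreeBelow d s s'' :=
  ⟨h'.1.trans h.1, fun i hi => (h'.2 i hi).trans (h.2 i hi)⟩

theorem mono (h : AgreeBelow d s s') (hd : d' ≤ d) : AgreeBelow d' s s' :=
  ⟨h.1, fun i hi => h.2 i (hi.trans_le hd)⟩

theorem setReg (h : AgreeBelow d s s') (hx : d ≤ x) : AgreeBelow d s (s'.setReg x v) :=
  ⟨h.1, fun i hi => by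
    rw [State.reg_setReg, if_neg (hi.trans_le hx).ne, h.2 i hi]⟩

end AgreeBelow

end BCol

namespace BCol

open Polynomial

/-! ### Functions computable in polynomial time -/

/-- Tuples of natural numbers, the variables of a computation. The instances make `ℕ` a one-tuple
and `Γ × ℕ` the extension of `Γ` by one more variable, in the last position. -/
class Context (Γ : Type) where
  size : ℕ
  get : Γ → ℕ → ℕ

instance : Context ℕ := ⟨1, fun x _ => x⟩

instance {Γ : Type} [Context Γ] : Context (Γ × ℕ) :=
  ⟨Context.size Γ + 1, fun x i => if i = Context.size Γ then x.2 else Context.get x.1 i⟩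

section

variable {Γ : Type} [Context Γ]

theorem Context.get_prod_size (x : Γ × ℕ) : get x (size Γ) = x.2 := if_pos rfl

theorem Context.get_prod_of_lt (x : Γ × ℕ) {i : ℕ} (hi : i < size Γ) : get x i = get x.1 i :=
  if_neg hi.ne

/-- All entries of the array `A` and all variables in `γ` are at most `N`. -/
def BoundedBy (N : ℕ) (A : ℕ → ℕ) (γ : Γ) : Prop :=
  (∀ i, A i ≤ N) ∧ ∀ i < Context.size Γ, Context.get γ i ≤ N

namespace BoundedBy

variable {N M y : ℕ} {A : ℕ → ℕ} {γ : Γ}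

theorem mono (h : BoundedBy N A γ) (hNM : N ≤ M) : BoundedBy M A γ :=
  ⟨fun i => (h.1 i).trans hNM, fun i hi => (h.2 i hi).trans hNM⟩

theorem prodMk (h : BoundedBy N A γ) (hy : y ≤ N) : BoundedBy N A (γ, y) := by
  refine ⟨h.1, fun i hi => ?_⟩
  rcases Nat.lt_succ_iff_lt_or_eq.1 hi with hi | rfl
  · exact (Context.get_prod_of_lt _ hi).trans_le (h.2 i hi)
  · exact (Context.get_prod_size _).trans_le hy

theorem fst {x : Γ × ℕ} (h : BoundedBy N A x) : BoundedBy N A x.1 :=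
  ⟨h.1, fun i hi => (Context.get_prod_of_lt x hi).ge.trans (h.2 i (Nat.lt_succ_of_lt hi))⟩

end BoundedBy

/-- The memory `s` holds the array `A` and, in the registers `π 0, π 1, …`, the variables `γ`. -/
def Holds (π : ℕ → ℕ) (A : ℕ → ℕ) (γ : Γ) (s : State) : Prop :=
  s.arr 0 = A ∧ ∀ i < Context.size Γ, s.reg (π i) = Context.get γ i

namespace Holds

variable {π : ℕ → ℕ} {A : ℕ → ℕ} {γ : Γ} {s s' : State} {d x y : ℕ}

theorem of_agreeBelow (h : Holds π A γ s) (hπ : ∀ i < Context.size Γ, π i < d)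
    (hs : AgreeBelow d s s') : Holds π A γ s' :=
  ⟨hs.1 ▸ h.1, fun i hi => (hs.2 _ (hπ i hi)).trans (h.2 i hi)⟩

theorem prodMk (h : Holds π A γ s) (hx : s.reg x = y) :
    Holds (Function.update π (Context.size Γ) x) A (γ, y) s := by
  refine ⟨h.1, fun i hi => ?_⟩
  rcases Nat.lt_succ_iff_lt_or_eq.1 hi with hi | rfl
  · rw [Function.update_of_ne hi.ne, Context.get_prod_of_lt _ hi, h.2 i hi]
  · rw [Function.update_self, Context.get_prod_size, hx]

theorem fst {x : Γ × ℕ} (h : Holds π A x s) : Holds π A x.1 s :=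
  ⟨h.1, fun i hi => (h.2 i (Nat.lt_succ_of_lt hi)).trans (Context.get_prod_of_lt x hi)⟩

end Holds

theorem update_lt_of_forall_lt {π : ℕ → ℕ} {d x : ℕ} (hπ : ∀ i < Context.size Γ, π i < d)
    (hx : x < d) : ∀ i < Context.size (Γ × ℕ), Function.update π (Context.size Γ) x i < d := by
  intro i hi
  rcases Nat.lt_succ_iff_lt_or_eq.1 hi with hi | rfl
  · rw [Function.update_of_ne hi.ne]
    exact hπ i hi
  · rwa [Function.update_self]

/-- Assertions about the memory, relative to the first register `d` of the work space, the input
array and the variables. -/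
abbrev Assertion (Γ : Type) : Type := ℕ → (ℕ → ℕ) → Γ → State → Prop

/-- A Hoare triple with a time bound that is polynomial in the numbers involved. The program may
depend on the registers `π` of the variables and on the work space, the registers from `d` on; it
changes nothing outside of the work space. -/
def PolyTriple (P Q : Assertion Γ) : Prop :=
  ∃ q : ℕ[X], ∀ (π : ℕ → ℕ) (d : ℕ), (∀ i < Context.size Γ, π i < d) → ∃ p : Prog,
    ∀ N A γ s, BoundedBy N A γ → Holds π A γ s → P d A γ s →
      HaltsWithin p s (q.eval N) fun s' => Q d A γ s' ∧ AgreeBelow d s s'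

/-- The values of `f` are bounded by a polynomial in the numbers involved. -/
def PolyBounded (f : (ℕ → ℕ) → Γ → ℕ) : Prop :=
  ∃ q : ℕ[X], ∀ N A γ, BoundedBy N A γ → f A γ ≤ q.eval N

/-- The function `f` of an array and of the variables in `Γ` is computed by a program in time
polynomial in the numbers (not in their lengths) that are involved. -/
structure PolyTime (f : (ℕ → ℕ) → Γ → ℕ) : Prop where
  polyBounded : PolyBounded f
  eval : PolyTriple (fun _ _ _ _ => True) fun d A γ s => s.reg d = f A γ

namespace PolyTriple

variable {P Q R : Assertion Γ} {f g : (ℕ → ℕ) → Γ → ℕ}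

theorem instr (op : (ℕ → ℕ) → ℕ → Prog)
    (hop : ∀ π d A γ s, (∀ i < Context.size Γ, π i < d) → Holds π A γ s → P d A γ s →
      HaltsWithin (op π d) s 1 fun s' => Q d A γ s' ∧ AgreeBelow d s s') : PolyTriple P Q :=
  ⟨1, fun π d hπ => ⟨op π d, fun N A γ s _ hs hP =>
    (hop π d A γ s hπ hs hP).mono (by rw [eval_one]) fun _ => id⟩⟩

theorem seq (h : PolyTriple P Q) (h' : PolyTriple Q R) : PolyTriple P R := by
  obtain ⟨q, hq⟩ := h
  obtain ⟨q', hq'⟩ := h'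
  refine ⟨q + q', fun π d hπ => ?_⟩
  obtain ⟨p, hp⟩ := hq π d hπ
  obtain ⟨p', hp'⟩ := hq' π d hπ
  refine ⟨.seq p p', fun N A γ s hN hs hP => ?_⟩
  rw [eval_add]
  refine HaltsWithin.seq ((hp N A γ s hN hs hP).mono le_rfl fun s₁ ⟨hQ, hs₁⟩ => ?_)
  exact (hp' N A γ s₁ hN (hs.of_agreeBelow hπ hs₁) hQ).mono le_rfl
    fun s₂ ⟨hR, hs₂⟩ => ⟨hR, hs₁.trans hs₂⟩

theorem evalNext (hf : PolyTime f) (hg : PolyTime g) :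
    PolyTriple (fun _ _ _ _ => True)
      fun d A γ s => s.reg d = f A γ ∧ s.reg (d + 1) = g A γ := by
  refine hf.eval.seq ?_
  obtain ⟨q, hq⟩ := hg.eval
  refine ⟨q, fun π d hπ => ?_⟩
  obtain ⟨p, hp⟩ := hq π (d + 1) fun i hi => Nat.lt_succ_of_lt (hπ i hi)
  exact ⟨p, fun N A γ s hN hs hfs => (hp N A γ s hN hs trivial).mono le_rfl fun s' ⟨hgs, hs'⟩ =>
    ⟨⟨(hs'.2 d d.lt_succ_self).trans hfs, hgs⟩, hs'.mono d.le_succ⟩⟩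

theorem ite_lt (hf : PolyTime f) (hg : PolyTime g)
    (hQ : PolyTriple (fun _ _ _ _ => True) fun d A γ s => f A γ < g A γ → Q d A γ s)
    (hQ' : PolyTriple (fun _ _ _ _ => True) fun d A γ s => ¬ f A γ < g A γ → Q d A γ s) :
    PolyTriple (fun _ _ _ _ => True) Q := by
  refine (evalNext hf hg).seq ?_
  obtain ⟨q, hq⟩ := hQ
  obtain ⟨q', hq'⟩ := hQ'
  refine ⟨q + q' + 1, fun π d hπ => ?_⟩
  obtain ⟨p, hp⟩ := hq π d hπ
  obtain ⟨p', hp'⟩ := hq' π d hπ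
  refine ⟨.ite d (d + 1) p p', fun N A γ s hN hs ⟨hfs, hgs⟩ => ?_⟩
  rw [eval_add, eval_add, eval_one]
  refine HaltsWithin.ite ?_ ?_ <;> rw [hfs, hgs] <;> intro hlt
  · exact (hp N A γ s hN hs trivial).mono (Nat.le_add_right _ _) fun s' ⟨h, hs'⟩ => ⟨h hlt, hs'⟩
  · exact (hp' N A γ s hN hs trivial).mono (Nat.le_add_left _ _) fun s' ⟨h, hs'⟩ => ⟨h hlt, hs'⟩

theorem mono (h : PolyTriple P Q) (hQR : ∀ d A γ s, Q d A γ s → R d A γ s) : PolyTriple P R := by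
  obtain ⟨q, hq⟩ := h
  refine ⟨q, fun π d hπ => ?_⟩
  obtain ⟨p, hp⟩ := hq π d hπ
  exact ⟨p, fun N A γ s hN hs hP => (hp N A γ s hN hs hP).mono le_rfl
    fun s' ⟨hQ, hs'⟩ => ⟨hQR d A γ s' hQ, hs'⟩⟩

end PolyTriple

namespace PolyTime

variable {f g u v : (ℕ → ℕ) → Γ → ℕ}

theorem const (c : ℕ) : PolyTime fun (_ : ℕ → ℕ) (_ : Γ) => c where
  polyBounded := ⟨C c, fun N A γ _ => eval_C.ge⟩
  eval := .instr (fun _ d => .const d c) fun _ d _ _ s _ _ _ =>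
    .const ⟨by simp, (AgreeBelow.refl d s).setReg le_rfl⟩

theorem get {i : ℕ} (hi : i < Context.size Γ) :
    PolyTime fun (_ : ℕ → ℕ) (γ : Γ) => Context.get γ i where
  polyBounded := ⟨X, fun N A γ hN => by rw [eval_X]; exact hN.2 i hi⟩
  eval := (const 0).eval.seq <| .instr (fun π d => .add d (π i) d) fun _ d _ _ s _ hs hd =>
    .add ⟨by simp [hs.2 i hi, hd], (AgreeBelow.refl d s).setReg le_rfl⟩

theorem nat : PolyTime fun (_ : ℕ → ℕ) (x : ℕ) => x :=
  get (Γ := ℕ) Nat.zero_lt_one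

theorem snd : PolyTime fun (_ : ℕ → ℕ) (x : Γ × ℕ) => x.2 := by
  simpa only [Context.get_prod_size] using get (Γ := Γ × ℕ) (Nat.lt_succ_self (Context.size Γ))

theorem weaken (hf : PolyTime f) : PolyTime fun A (x : Γ × ℕ) => f A x.1 := by
  obtain ⟨⟨q, hq⟩, q', hq'⟩ := hf
  refine ⟨⟨q, fun N A x hN => hq N A x.1 hN.fst⟩, q', fun π d hπ => ?_⟩
  obtain ⟨p, hp⟩ := hq' π d fun i hi => hπ i (Nat.lt_succ_of_lt hi)
  exact ⟨p, fun N A x s hN hs => hp N A x.1 s hN.fst hs.fst⟩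

theorem add (hf : PolyTime f) (hg : PolyTime g) : PolyTime fun A γ => f A γ + g A γ where
  polyBounded := by
    obtain ⟨q, hq⟩ := hf.polyBounded
    obtain ⟨q', hq'⟩ := hg.polyBounded
    exact ⟨q + q', fun N A γ hN => by
      rw [eval_add]; exact add_le_add (hq N A γ hN) (hq' N A γ hN)⟩
  eval := (PolyTriple.evalNext hf hg).seq <| .instr (fun _ d => .add d d (d + 1))
    fun _ d _ _ s _ _ ⟨hfs, hgs⟩ =>
      .add ⟨by simp [hfs, hgs], (AgreeBelow.refl d s).setReg le_rfl⟩

theorem sub (hf : PolyTime f) (hg : PolyTime g) : PolyTime fun A γ => f A γ - g A γ where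
  polyBounded := by
    obtain ⟨q, hq⟩ := hf.polyBounded
    exact ⟨q, fun N A γ hN => (Nat.sub_le _ _).trans (hq N A γ hN)⟩
  eval := (PolyTriple.evalNext hf hg).seq <| .instr (fun _ d => .sub d d (d + 1))
    fun _ d _ _ s _ _ ⟨hfs, hgs⟩ =>
      .sub ⟨by simp [hfs, hgs], (AgreeBelow.refl d s).setReg le_rfl⟩

theorem arr (hf : PolyTime f) : PolyTime fun A γ => A (f A γ) where
  polyBounded := ⟨X, fun N A γ hN => by rw [eval_X]; exact hN.1 _⟩
  eval := hf.eval.seq <| .instr (fun _ d => .load d 0 d) fun _ d _ _ s _ hs hfs =>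
    .load ⟨by simp [hfs, hs.1], (AgreeBelow.refl d s).setReg le_rfl⟩

theorem ite_lt (hf : PolyTime f) (hg : PolyTime g) (hu : PolyTime u) (hv : PolyTime v) :
    PolyTime fun A γ => if f A γ < g A γ then u A γ else v A γ where
  polyBounded := by
    obtain ⟨q, hq⟩ := hu.polyBounded
    obtain ⟨q', hq'⟩ := hv.polyBounded
    refine ⟨q + q', fun N A γ hN => ?_⟩
    have hq := hq N A γ hN
    have hq' := hq' N A γ hN
    rw [eval_add]
    dsimp only
    split_ifs <;> omega
  eval := .ite_lt hf hg (hu.eval.mono fun _ _ _ _ hd hlt => hd.trans (if_pos hlt).symm)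
    (hv.eval.mono fun _ _ _ _ hd hlt => hd.trans (if_neg hlt).symm)

end PolyTime

/-- Iterates `body`, which leaves its result in register `d + 5`: register `d` is the accumulator,
register `d + 1` the number of iterations, register `d + 2` the counter. -/
def Prog.fold (body : Prog) (d : ℕ) : Prog :=
  .seq (.const (d + 2) 0) <| .seq (.const (d + 3) 1) <| .seq (.const (d + 4) 0) <|
    .loop (d + 2) (d + 1) <| .seq body <|
      .seq (.add d (d + 5) (d + 4)) (.add (d + 2) (d + 2) (d + 3))

/-- The invariant of the loop in `Prog.fold` after `i` of `m` iterations, where `acc i` is the value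
of the accumulator and `s₀` is the memory at the start. -/
structure FoldInvariant (d m : ℕ) (acc : ℕ → ℕ) (s₀ : State) (i : ℕ) (s : State) : Prop where
  agreeBelow : AgreeBelow d s₀ s
  acc_eq : s.reg d = acc i
  bound_eq : s.reg (d + 1) = m
  counter_eq : s.reg (d + 2) = i
  one_eq : s.reg (d + 3) = 1
  zero_eq : s.reg (d + 4) = 0

theorem HaltsWithin.fold {body : Prog} {d m T : ℕ} {acc : ℕ → ℕ} {s₀ : State}
    (hacc : s₀.reg d = acc 0) (hm : s₀.reg (d + 1) = m)
    (hbody : ∀ i < m, ∀ s, AgreeBelow d s₀ s → s.reg d = acc i → s.reg (d + 2) = i →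
      HaltsWithin body s T fun s' => s'.reg (d + 5) = acc (i + 1) ∧ AgreeBelow (d + 5) s s') :
    HaltsWithin (body.fold d) s₀ (m * (T + 3) + 4)
      fun s => s.reg d = acc m ∧ AgreeBelow d s₀ s := by
  have hloop : ∀ s, FoldInvariant d m acc s₀ 0 s → HaltsWithin (.loop (d + 2) (d + 1) <|
      .seq body <| .seq (.add d (d + 5) (d + 4)) (.add (d + 2) (d + 2) (d + 3))) s
      (m * (T + 3) + 1) (FoldInvariant d m acc s₀ m) := fun s hs =>
    .countedLoop _ (fun _ _ h => h.counter_eq) (fun _ _ h => h.bound_eq)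
      (fun i hi s hs => .seq <| (hbody i hi s hs.agreeBelow hs.acc_eq hs.counter_eq).mono le_rfl
        fun s' ⟨hacc', hs'⟩ => .seq <| .add <| .add
          { agreeBelow := ((hs.agreeBelow.trans (hs'.mono (by omega))).setReg le_rfl).setReg
              (by omega)
            acc_eq := by simp [hacc', hs'.2, hs.zero_eq]
            bound_eq := by simp [hs'.2, hs.bound_eq]
            counter_eq := by simp [hs'.2, hs.counter_eq, hs.one_eq]
            one_eq := by simp [hs'.2, hs.one_eq]
            zero_eq := by simp [hs'.2, hs.zero_eq] }) hs
  have hinit : FoldInvariant d m acc s₀ 0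
      (((s₀.setReg (d + 2) 0).setReg (d + 3) 1).setReg (d + 4) 0) :=
    { agreeBelow := (((AgreeBelow.refl d s₀).setReg (by omega)).setReg (by omega)).setReg
        (by omega)
      acc_eq := by simp [hacc]
      bound_eq := by simp [hm]
      counter_eq := by simp
      one_eq := by simp
      zero_eq := by simp }
  exact (HaltsWithin.seq <| .const <| .seq <| .const <| .seq <| .const <| hloop _ hinit).mono
    (by omega) fun s hs => ⟨hs.acc_eq, hs.agreeBelow⟩

namespace PolyTime

variable {f g m init : (ℕ → ℕ) → Γ → ℕ}

theorem fold {body : (ℕ → ℕ) → Γ → ℕ → ℕ → ℕ} (hm : PolyTime m) (hinit : PolyTime init)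
    (hbody : PolyTime fun A (x : (Γ × ℕ) × ℕ) => body A x.1.1 x.1.2 x.2)
    (hbound : ∃ q : ℕ[X], ∀ N A γ, BoundedBy N A γ → ∀ j ≤ m A γ,
      Nat.fold j (fun i _ acc => body A γ i acc) (init A γ) ≤ q.eval N) :
    PolyTime fun A γ => Nat.fold (m A γ) (fun i _ acc => body A γ i acc) (init A γ) := by
  obtain ⟨q, hq⟩ := hbound
  obtain ⟨q₁, hq₁⟩ := hm.polyBounded
  obtain ⟨q₂, hq₂⟩ := hbody.eval
  refine ⟨⟨q, fun N A γ hN => hq N A γ hN _ le_rfl⟩, (PolyTriple.evalNext hinit hm).seq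
    ⟨q₁ * (q₂.comp (X + q₁ + q) + 3) + 4, fun π d hπ => ?_⟩⟩
  have hπ' : ∀ i < Context.size Γ, π i < d + 5 := fun i hi => (hπ i hi).trans_le (by omega)
  obtain ⟨p, hp⟩ := hq₂ _ (d + 5) (update_lt_of_forall_lt
    (update_lt_of_forall_lt hπ' (x := d + 2) (by omega)) (x := d) (by omega))
  refine ⟨p.fold d, fun N A γ s hN hs ⟨hinits, hms⟩ => (HaltsWithin.fold
    (T := q₂.eval ((X + q₁ + q).eval N))
    (acc := fun j => Nat.fold j (fun i _ acc => body A γ i acc) (init A γ)) hinits hms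
    fun i hi s' hs' hacc hcounter => ?_).mono ?_ fun _ => id⟩
  · have hmN := hq₁ N A γ hN
    have haccN := hq N A γ hN i hi.le
    have hbounded : BoundedBy ((X + q₁ + q).eval N) A ((γ, i), s'.reg d) := by
      rw [eval_add, eval_add, eval_X]
      exact ((hN.mono (by omega)).prodMk (by omega)).prodMk (by rw [hacc]; omega)
    have hholds := ((hs.of_agreeBelow hπ hs').prodMk hcounter).prodMk (x := d) rfl
    refine (hp _ A _ s' hbounded hholds trivial).mono le_rfl fun s'' ⟨hres, hs''⟩ => ⟨?_, hs''⟩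
    rw [hres, hacc, Nat.fold_succ]
  · simp only [eval_add, eval_mul, eval_comp, eval_ofNat]
    gcongr
    exact hq₁ N A γ hN

theorem sum {f : (ℕ → ℕ) → Γ → ℕ → ℕ} (hm : PolyTime m)
    (hf : PolyTime fun A (x : Γ × ℕ) => f A x.1 x.2) :
    PolyTime fun A γ => ∑ i ∈ Finset.range (m A γ), f A γ i := by
  have hfold : ∀ A γ j, Nat.fold j (fun i _ acc => acc + f A γ i) 0 =
      ∑ i ∈ Finset.range j, f A γ i := by
    intro A γ j
    induction j with
    | zero => rfl
    | succ j ih => rw [Nat.fold_succ, ih, Finset.sum_range_succ]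
  simp only [← hfold]
  refine fold hm (const 0) (snd.add hf.weaken) ?_
  obtain ⟨q₁, hq₁⟩ := hm.polyBounded
  obtain ⟨q₂, hq₂⟩ := hf.polyBounded
  refine ⟨q₁ * q₂.comp (X + q₁), fun N A γ hN j hj => ?_⟩
  have hmN := hq₁ N A γ hN
  have hfN : ∀ i ∈ Finset.range j, f A γ i ≤ q₂.eval (N + q₁.eval N) := fun i hi =>
    hq₂ _ A (γ, i) ((hN.mono (Nat.le_add_right _ _)).prodMk (by
      have := Finset.mem_range.1 hi
      omega))
  rw [hfold, eval_mul, eval_comp, eval_add, eval_X]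
  calc ∑ i ∈ Finset.range j, f A γ i ≤ j * q₂.eval (N + q₁.eval N) := by
        simpa using Finset.sum_le_card_nsmul _ _ _ hfN
    _ ≤ q₁.eval N * q₂.eval (N + q₁.eval N) := Nat.mul_le_mul_right _ (hj.trans hmN)

theorem mul (hf : PolyTime f) (hg : PolyTime g) : PolyTime fun A γ => f A γ * g A γ := by
  simpa using sum (f := fun A γ _ => g A γ) hf hg.weaken

theorem pow (hf : PolyTime f) (c : ℕ) : PolyTime fun A γ => f A γ ^ c := by
  induction c with
  | zero => simpa only [pow_zero] using const 1
  | succ c ih => simpa only [pow_succ] using ih.mul hf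

end PolyTime

/-- The predicate `P` on an array and the variables in `Γ` is decided by a program in time
polynomial in the numbers involved: it has the form `0 < f` for a computable `f`. -/
def PolyTimePred (P : (ℕ → ℕ) → Γ → Prop) : Prop :=
  ∃ f : (ℕ → ℕ) → Γ → ℕ, PolyTime f ∧ ∀ A γ, P A γ ↔ 0 < f A γ

theorem PolyTime.ite {P : (ℕ → ℕ) → Γ → Prop} [∀ A γ, Decidable (P A γ)]
    {u v : (ℕ → ℕ) → Γ → ℕ} (hP : PolyTimePred P) (hu : PolyTime u) (hv : PolyTime v) :
    PolyTime fun A γ => if P A γ then u A γ else v A γ := by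
  obtain ⟨f, hf, hPf⟩ := hP
  simpa only [hPf] using (const 0).ite_lt hf hu hv

namespace PolyTimePred

variable {P Q : (ℕ → ℕ) → Γ → Prop} {f g m : (ℕ → ℕ) → Γ → ℕ}

open PolyTime

theorem lt (hf : PolyTime f) (hg : PolyTime g) : PolyTimePred fun A γ => f A γ < g A γ :=
  ⟨_, hg.sub hf, fun _ _ => Nat.sub_pos_iff_lt.symm⟩

theorem not (hP : PolyTimePred P) : PolyTimePred fun A γ => ¬ P A γ := by
  obtain ⟨f, hf, hPf⟩ := hP
  exact ⟨_, (const 1).sub hf, fun A γ => by simp only [hPf]; omega⟩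

theorem and (hP : PolyTimePred P) (hQ : PolyTimePred Q) :
    PolyTimePred fun A γ => P A γ ∧ Q A γ := by
  obtain ⟨f, hf, hPf⟩ := hP
  obtain ⟨g, hg, hQg⟩ := hQ
  exact ⟨_, hf.mul hg, fun A γ => by simp only [hPf, hQg, Nat.pos_iff_ne_zero, mul_ne_zero_iff]⟩

theorem or (hP : PolyTimePred P) (hQ : PolyTimePred Q) :
    PolyTimePred fun A γ => P A γ ∨ Q A γ := by
  obtain ⟨f, hf, hPf⟩ := hP
  obtain ⟨g, hg, hQg⟩ := hQ
  exact ⟨_, hf.add hg, fun A γ => by simp only [hPf, hQg, Nat.add_pos_iff_pos_or_pos]⟩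

theorem imp (hP : PolyTimePred P) (hQ : PolyTimePred Q) :
    PolyTimePred fun A γ => P A γ → Q A γ := by
  simpa only [imp_iff_not_or] using hP.not.or hQ

theorem le (hf : PolyTime f) (hg : PolyTime g) : PolyTimePred fun A γ => f A γ ≤ g A γ := by
  simpa only [not_lt] using (lt hg hf).not

theorem eq (hf : PolyTime f) (hg : PolyTime g) : PolyTimePred fun A γ => f A γ = g A γ := by
  simpa only [← le_antisymm_iff] using (le hf hg).and (le hg hf)

theorem exists_lt {P : (ℕ → ℕ) → Γ → ℕ → Prop} (hm : PolyTime m)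
    (hP : PolyTimePred fun A (x : Γ × ℕ) => P A x.1 x.2) :
    PolyTimePred fun A γ => ∃ i < m A γ, P A γ i := by
  obtain ⟨f, hf, hPf⟩ := hP
  refine ⟨_, hm.sum (f := fun A γ i => f A (γ, i)) hf, fun A γ => ?_⟩
  simp [Finset.sum_pos_iff, ← hPf]

theorem forall_lt {P : (ℕ → ℕ) → Γ → ℕ → Prop} (hm : PolyTime m)
    (hP : PolyTimePred fun A (x : Γ × ℕ) => P A x.1 x.2) :
    PolyTimePred fun A γ => ∀ i < m A γ, P A γ i := by
  simpa only [not_exists, not_and, not_not] using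
    (exists_lt (P := fun A γ i => ¬ P A γ i) hm hP.not).not

end PolyTimePred

namespace PolyTime

variable {f g h m : (ℕ → ℕ) → Γ → ℕ}

theorem count {P : (ℕ → ℕ) → Γ → ℕ → Prop} [∀ A γ, DecidablePred (P A γ)] (hm : PolyTime m)
    (hP : PolyTimePred fun A (x : Γ × ℕ) => P A x.1 x.2) :
    PolyTime fun A γ => Nat.count (P A γ) (m A γ) := by
  simpa only [Nat.count_eq_card_filter_range, Finset.card_filter] using
    hm.sum (ite hP (const 1) (const 0))

theorem div (hf : PolyTime f) (hg : PolyTime g) : PolyTime fun A γ => f A γ / g A γ := by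
  have hdiv : ∀ a b : ℕ, a / b =
      if 0 < b then Nat.count (fun i => (i + 1) * b ≤ a) a else 0 := by
    intro a b
    split_ifs with hb
    · have hquot : (Finset.range a).filter (· < a / b) = Finset.range (a / b) := by
        ext i
        simpa using fun hi : i < a / b => hi.trans_le (Nat.div_le_self a b)
      simp only [← Nat.le_div_iff_mul_le hb, Nat.succ_le_iff, Nat.count_eq_card_filter_range,
        hquot, Finset.card_range]
    · rw [Nat.eq_zero_of_not_pos hb, Nat.div_zero]
  simp only [hdiv]
  exact ite (.lt (const 0) hg) (count hf (.le ((snd.add (const 1)).mul hg.weaken) hf.weaken))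
    (const 0)

theorem mod (hf : PolyTime f) (hg : PolyTime g) : PolyTime fun A γ => f A γ % g A γ := by
  simpa only [← Nat.mod_eq_sub] using hf.sub (hg.mul (hf.div hg))

theorem div_pow (hf : PolyTime f) (hg : PolyTime g) (hh : PolyTime h) :
    PolyTime fun A γ => f A γ / g A γ ^ h A γ := by
  have hfold : ∀ a b j : ℕ, a / b ^ j = Nat.fold j (fun _ _ acc => acc / b) a := by
    intro a b j
    induction j with
    | zero => simp
    | succ j ih => rw [Nat.fold_succ, ← ih, Nat.div_div_eq_div_mul, pow_succ]
  simp only [hfold]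
  refine fold hh hf (snd.div hg.weaken.weaken) ?_
  obtain ⟨q, hq⟩ := hf.polyBounded
  exact ⟨q, fun N A γ hN j _ => hfold _ _ j ▸ (Nat.div_le_self _ _).trans (hq N A γ hN)⟩

end PolyTime

end

end BCol

namespace BCol

open SimpleGraph

/-! ### Precolorings that extend to b-colorings -/

section

variable {V α : Type*} {G : SimpleGraph V} {k : ℕ}

theorem exists_forall_adj_ne_of_degree_lt [Fintype α] [G.LocallyFinite] {v : V}
    (hv : G.degree v < Fintype.card α) (f : V → α) : ∃ a, ∀ u, G.Adj v u → f u ≠ a := by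
  classical
  by_contra! hcon
  have hsurj : (Finset.univ : Finset α) ⊆ (G.neighborFinset v).image f := fun a _ => by
    obtain ⟨u, hvu, hua⟩ := hcon a
    exact Finset.mem_image.2 ⟨u, (G.mem_neighborFinset v u).2 hvu, hua⟩
  have hcard := (Finset.card_le_card hsurj).trans Finset.card_image_le
  rw [Finset.card_univ, card_neighborFinset_eq_degree] at hcard
  omega

theorem card_le_degree_add_one_of_forall_exists_adj [Fintype α] [G.LocallyFinite] {v : V}
    {f : V → α} (hv : ∀ a, a ≠ f v → ∃ u, G.Adj v u ∧ f u = a) :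
    Fintype.card α ≤ G.degree v + 1 := by
  classical
  have hsurj : (Finset.univ : Finset α).erase (f v) ⊆ (G.neighborFinset v).image f := by
    intro a ha
    obtain ⟨u, hvu, hua⟩ := hv a (Finset.ne_of_mem_erase ha)
    exact Finset.mem_image.2 ⟨u, (G.mem_neighborFinset v u).2 hvu, hua⟩
  have hcard := (Finset.card_le_card hsurj).trans Finset.card_image_le
  rw [Finset.card_erase_of_mem (Finset.mem_univ _), Finset.card_univ,
    card_neighborFinset_eq_degree] at hcard
  omega

theorem exists_coloring_eqOn [Fintype α] [Finite V] [G.LocallyFinite] {S : Set V} {f : V → α}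
    (hf : ∀ u ∈ S, ∀ v ∈ S, G.Adj u v → f u ≠ f v)
    (hdeg : ∀ v ∉ S, G.degree v < Fintype.card α) :
    ∃ φ : G.Coloring α, S.EqOn φ f := by
  classical
  have := Fintype.ofFinite V
  suffices hext : ∀ T : Finset V, ∃ g : V → α, S.EqOn g f ∧
      ∀ u ∈ S ∪ T, ∀ v ∈ S ∪ T, G.Adj u v → g u ≠ g v by
    obtain ⟨g, hgS, hg⟩ := hext Finset.univ
    exact ⟨.mk g fun huv => hg _ (by simp) _ (by simp) huv, hgS⟩
  intro T
  induction T using Finset.induction_on with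
  | empty => exact ⟨f, Set.eqOn_refl f S, by simpa using hf⟩
  | insert w T _ ih =>
    obtain ⟨g, hgS, hg⟩ := ih
    rw [Finset.coe_insert, Set.union_insert]
    by_cases hw : w ∈ S
    · rw [Set.insert_eq_of_mem (Set.mem_union_left _ hw)]
      exact ⟨g, hgS, hg⟩
    · obtain ⟨a, ha⟩ := exists_forall_adj_ne_of_degree_lt (hdeg w hw) g
      refine ⟨Function.update g w a, fun v hv => ?_, fun u hu v hv huv => ?_⟩
      · rw [Function.update_of_ne (ne_of_mem_of_not_mem hv hw), hgS hv]
      · rcases eq_or_ne u w with rfl | huw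
        · rw [Function.update_self, Function.update_of_ne huv.ne']
          exact (ha v huv).symm
        · rcases eq_or_ne v w with rfl | hvw
          · rw [Function.update_self, Function.update_of_ne huw]
            exact ha u huv.symm
          · rw [Function.update_of_ne huw, Function.update_of_ne hvw]
            exact hg u (hu.resolve_left huw) v (hv.resolve_left hvw) huv

/-- The sets `C j` are the color classes of a proper coloring of a part of `G` that contains a
b-vertex of every color, with the neighbors it needs, and all vertices of degree at least `k`. -/
structure IsBPrecoloring (G : SimpleGraph V) [G.LocallyFinite] (C : Fin k → Set V) : Prop where
  eq_of_mem : ∀ ⦃v i j⦄, v ∈ C i → v ∈ C j → i = j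
  not_adj : ∀ ⦃j u v⦄, u ∈ C j → v ∈ C j → ¬ G.Adj u v
  exists_bVertex : ∀ i, ∃ v ∈ C i, ∀ j, j ≠ i → ∃ u ∈ C j, G.Adj v u
  exists_mem : ∀ v, k ≤ G.degree v → ∃ j, v ∈ C j

theorem IsBPrecoloring.hasBColoring [Finite V] [G.LocallyFinite] {C : Fin k → Set V}
    (hC : IsBPrecoloring G C) : HasBColoring G k := by
  have hex : ∀ v, ∃ a : Fin k, ∀ j, v ∈ C j → a = j := fun v => by
    by_cases hv : ∃ j, v ∈ C j
    · exact hv.imp fun i hi j hj => hC.eq_of_mem hi hj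
    · have hdeg : G.degree v < k := not_le.1 (mt (hC.exists_mem v) hv)
      exact ⟨⟨0, by omega⟩, fun j hj => (hv ⟨j, hj⟩).elim⟩
  choose f hf using hex
  obtain ⟨φ, hφ⟩ := exists_coloring_eqOn (G := G) (S := {v | ∃ j, v ∈ C j}) (f := f)
    (fun u ⟨i, hu⟩ v ⟨j, hv⟩ huv hfuv => by
      rw [hf u i hu, hf v j hv] at hfuv
      subst hfuv
      exact hC.not_adj hu hv huv)
    (fun v hv => by
      rw [Fintype.card_fin]
      exact not_le.1 (mt (hC.exists_mem v) hv))
  have hcol : ∀ {v j}, v ∈ C j → φ v = j := fun hv => (hφ ⟨_, hv⟩).trans (hf _ _ hv)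
  refine ⟨φ, fun i => ?_⟩
  obtain ⟨v, hv, hnbrs⟩ := hC.exists_bVertex i
  refine ⟨v, hcol hv, fun j hj => ?_⟩
  obtain ⟨u, hu, hvu⟩ := hnbrs j hj
  exact ⟨u, hvu, hcol hu⟩

/-- The vertices that can serve in a b-coloring with `k` colors as b-vertices or as neighbors of
b-vertices: those at distance at most one from a vertex of degree at least `k - 1`. -/
def IsCandidate (G : SimpleGraph V) [G.LocallyFinite] (k : ℕ) (v : V) : Prop :=
  k ≤ G.degree v + 1 ∨ ∃ u, G.Adj v u ∧ k ≤ G.degree u + 1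

theorem IsBColoring.exists_adj_diagonal {φ : G.Coloring (Fin k)} (hφ : IsBColoring φ) :
    ∃ y : Fin k → Fin k → V, (∀ i j, φ (y i j) = j) ∧ ∀ i j, j ≠ i → G.Adj (y i i) (y i j) := by
  choose x hx y hy using hφ
  refine ⟨fun i j => if hj : j = i then x i else y i j hj, fun i j => ?_, fun i j hj => ?_⟩
  · dsimp only
    split_ifs with hj
    · rw [hx, hj]
    · exact (hy i j hj).2
  · dsimp only
    rw [dif_pos rfl, dif_neg hj]
    exact (hy i j hj).1

theorem HasBColoring.exists_isBPrecoloring [Fintype V] [DecidableRel G.Adj]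
    (h : HasBColoring G k) (hhigh : (Finset.univ.filter fun v => k ≤ G.degree v).card ≤ k) :
    ∃ W : Fin k → Finset V,
      (∀ j, (W j).Nonempty ∧ (W j).card ≤ 2 * k ∧ ∀ v ∈ W j, IsCandidate G k v) ∧
      IsBPrecoloring G fun j => (W j : Set V) := by
  classical
  obtain ⟨φ, hφ⟩ := h
  obtain ⟨y, hcol, hadj⟩ := hφ.exists_adj_diagonal
  have hdeg : ∀ i, k ≤ G.degree (y i i) + 1 := fun i => by
    simpa using card_le_degree_add_one_of_forall_exists_adj (f := φ) (v := y i i)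
      fun j hj => ⟨y i j, hadj i j (by rwa [hcol] at hj), hcol i j⟩
  let W : Fin k → Finset V := fun j =>
    Finset.univ.image (y · j) ∪ Finset.univ.filter fun v => k ≤ G.degree v ∧ φ v = j
  have hyW : ∀ i j, y i j ∈ W j := fun i j =>
    Finset.mem_union_left _ (Finset.mem_image_of_mem (y · j) (Finset.mem_univ i))
  have hWcol : ∀ {v j}, v ∈ W j → φ v = j := by
    intro v j hv
    rcases Finset.mem_union.1 hv with hv | hv
    · obtain ⟨i, -, rfl⟩ := Finset.mem_image.1 hv
      exact hcol i j
    · exact (Finset.mem_filter.1 hv).2.2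
  refine ⟨W, fun j => ⟨⟨y j j, hyW j j⟩, ?_, fun v hv => ?_⟩, ?_⟩
  · rw [two_mul]
    refine (Finset.card_union_le _ _).trans (add_le_add ?_ ?_)
    · simpa using Finset.card_image_le (s := Finset.univ) (f := (y · j))
    · exact (Finset.card_le_card (Finset.monotone_filter_right _ fun _ _ => And.left)).trans hhigh
  · rcases Finset.mem_union.1 hv with hv | hv
    · obtain ⟨i, -, rfl⟩ := Finset.mem_image.1 hv
      by_cases hj : j = i
      · exact Or.inl (hj ▸ hdeg j)
      · exact Or.inr ⟨y i i, (hadj i j hj).symm, hdeg i⟩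
    · exact Or.inl ((Finset.mem_filter.1 hv).2.1.trans (Nat.le_succ _))
  · exact
      { eq_of_mem := fun v i j hi hj => (hWcol hi).symm.trans (hWcol hj)
        not_adj := fun j u v hu hv huv => φ.valid huv ((hWcol hu).trans (hWcol hv).symm)
        exists_bVertex := fun i => ⟨y i i, hyW i i, fun j hj => ⟨y i j, hyW i j, hadj i j hj⟩⟩
        exists_mem := fun v hv => ⟨φ v, Finset.mem_coe.2 <| Finset.mem_union_right _ <|
          Finset.mem_filter.2 ⟨Finset.mem_univ v, hv, rfl⟩⟩ }

end

/-! ### Scattered vertices -/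

section

variable {V : Type*} {G : SimpleGraph V} {k Δ : ℕ}

theorem exists_edist_le_of_edist_le_add_one {v u : V} {r : ℕ} (h : G.edist v u ≤ (r + 1 : ℕ)) :
    ∃ w, (w = v ∨ G.Adj v w) ∧ G.edist w u ≤ r := by
  obtain ⟨p, hp⟩ := exists_walk_of_edist_ne_top (ne_top_of_le_ne_top (ENat.natCast_ne_top _) h)
  rw [← hp, Nat.cast_le] at h
  cases p with
  | nil => exact ⟨v, Or.inl rfl, by simp⟩
  | cons hvw p =>
    exact ⟨_, Or.inr hvw, (Walk.edist_le p).trans (Nat.cast_le.2 (Nat.succ_le_succ_iff.1 h))⟩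

section

variable [Fintype V]

open Classical in
/-- The ball of radius `r` around `v` in the graph distance, as a finite set. -/
noncomputable def closedBall (G : SimpleGraph V) (v : V) (r : ℕ) : Finset V :=
  Finset.univ.filter fun u => G.edist v u ≤ r

theorem mem_closedBall {v u : V} {r : ℕ} : u ∈ closedBall G v r ↔ G.edist v u ≤ r := by
  classical
  simp [closedBall]

theorem closedBall_one [DecidableEq V] [G.LocallyFinite] (v : V) :
    closedBall G v 1 = insert v (G.neighborFinset v) := by
  ext u
  rw [mem_closedBall, Nat.cast_one, edist_le_one_iff_adj_or_eq, Finset.mem_insert,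
    mem_neighborFinset, or_comm, eq_comm]

theorem card_closedBall_le [G.LocallyFinite] (hΔ : ∀ v, G.degree v ≤ Δ) (v : V) (r : ℕ) :
    (closedBall G v r).card ≤ (Δ + 1) ^ r := by
  classical
  induction r generalizing v with
  | zero =>
    refine Finset.card_le_one.2 fun a ha b hb => ?_
    simp only [mem_closedBall, Nat.cast_zero, nonpos_iff_eq_zero, edist_eq_zero_iff] at ha hb
    exact ha.symm.trans hb
  | succ r ih =>
    have hsub : closedBall G v (r + 1) ⊆
        (insert v (G.neighborFinset v)).biUnion fun w => closedBall G w r := by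
      intro u hu
      obtain ⟨w, hvw, hwu⟩ := exists_edist_le_of_edist_le_add_one (mem_closedBall.1 hu)
      exact Finset.mem_biUnion.2 ⟨w, by simpa using hvw, mem_closedBall.2 hwu⟩
    have hnbrs : (insert v (G.neighborFinset v)).card ≤ Δ + 1 :=
      (Finset.card_insert_le _ _).trans (by simpa using hΔ v)
    calc (closedBall G v (r + 1)).card
        ≤ (insert v (G.neighborFinset v)).card * (Δ + 1) ^ r :=
          (Finset.card_le_card hsub).trans (Finset.card_biUnion_le_card_mul _ _ _ fun w _ => ih w)
      _ ≤ (Δ + 1) * (Δ + 1) ^ r := Nat.mul_le_mul_right _ hnbrs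
      _ = (Δ + 1) ^ (r + 1) := (pow_succ' _ _).symm

theorem card_biUnion_closedBall_le [DecidableEq V] [G.LocallyFinite] (hΔ : ∀ v, G.degree v ≤ Δ)
    (X : Finset V) (r : ℕ) :
    (X.biUnion fun v => closedBall G v r).card ≤ X.card * (Δ + 1) ^ r :=
  Finset.card_biUnion_le_card_mul _ _ _ fun v _ => card_closedBall_le hΔ v r

end

theorem exists_subset_pairwise_lt_edist [Finite V] [G.LocallyFinite]
    (hΔ : ∀ v, G.degree v ≤ Δ) (r : ℕ) {m : ℕ} {D : Finset V} (hD : m * (Δ + 1) ^ r ≤ D.card) :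
    ∃ X ⊆ D, X.card = m ∧ (X : Set V).Pairwise fun u v => r < G.edist u v := by
  classical
  have := Fintype.ofFinite V
  induction m with
  | zero => exact ⟨∅, by simp⟩
  | succ m ih =>
    have hlt : m * (Δ + 1) ^ r < D.card := lt_of_lt_of_le (by gcongr; omega) hD
    obtain ⟨X, hXD, hXm, hX⟩ := ih hlt.le
    obtain ⟨y, hyD, hy⟩ := Finset.exists_mem_notMem_of_card_lt_card
      (((card_biUnion_closedBall_le hΔ X r).trans_eq (by rw [hXm])).trans_lt hlt)
    have hfar : ∀ x ∈ X, r < G.edist x y := fun x hx => by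
      simpa [mem_closedBall] using fun h => hy (Finset.mem_biUnion.2 ⟨x, hx, mem_closedBall.2 h⟩)
    have hyX : y ∉ X := fun h => by simpa using hfar y h
    refine ⟨insert y X, Finset.insert_subset hyD hXD, ?_, ?_⟩
    · rw [Finset.card_insert_of_notMem hyX, hXm]
    · rw [Finset.coe_insert]
      exact hX.insert fun x hx _ => ⟨edist_comm (G := G) ▸ hfar x hx, hfar x hx⟩

theorem exists_injOn_apply_eq {α β : Type*} [Fintype β] {s : Finset α}
    (hs : s.card ≤ Fintype.card β) (a : α) (b : β) : ∃ f : α → β, Set.InjOn f s ∧ f a = b := by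
  classical
  have : Nonempty β := ⟨b⟩
  obtain ⟨f, -, hf⟩ := s.finite_toSet.exists_injOn_of_encard_le
    (t := (Set.univ : Set β)) (by simpa [Set.encard_coe_eq_coe_finsetCard] using hs)
  exact ⟨Equiv.swap (f a) b ∘ f, (Equiv.injective _).comp_injOn hf, Equiv.swap_apply_left _ _⟩

theorem isBPrecoloring_of_separated_blocks [G.LocallyFinite] {ι : Type*} {B : ι → Set V}
    {f : ι → V → Fin k} (hf : ∀ b, Set.InjOn (f b) (B b))
    (hB : ∀ ⦃b c u v⦄, u ∈ B b → v ∈ B c → G.edist u v ≤ 1 → b = c)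
    (hbVertex : ∀ i, ∃ b, ∃ v ∈ B b, f b v = i ∧ ∀ j, j ≠ i → ∃ u ∈ B b, f b u = j ∧ G.Adj v u)
    (hmem : ∀ v, k ≤ G.degree v → ∃ b, v ∈ B b) :
    IsBPrecoloring G fun j => {v | ∃ b, v ∈ B b ∧ f b v = j} where
  eq_of_mem := by
    rintro v i j ⟨b, hb, rfl⟩ ⟨c, hc, rfl⟩
    obtain rfl := hB hb hc (by simp)
    rfl
  not_adj := by
    rintro j u v ⟨b, hb, hu⟩ ⟨c, hc, hv⟩ huv
    obtain rfl := hB hb hc (edist_eq_one_iff_adj.2 huv).le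
    exact huv.ne (hf b hb hc (hu.trans hv.symm))
  exists_bVertex := fun i => by
    obtain ⟨b, v, hv, hvi, hnbrs⟩ := hbVertex i
    refine ⟨v, ⟨b, hv, hvi⟩, fun j hj => ?_⟩
    obtain ⟨u, hu, huj, hvu⟩ := hnbrs j hj
    exact ⟨u, ⟨b, hu, huj⟩, hvu⟩
  exists_mem := fun v hv => by
    obtain ⟨b, hb⟩ := hmem v hv
    exact ⟨f b v, b, hb, rfl⟩

theorem edist_le_add_add {a b u v : V} {q r t : ℕ∞} (hau : G.edist a u ≤ q)
    (huv : G.edist u v ≤ r) (hvb : G.edist v b ≤ t) : G.edist a b ≤ q + r + t :=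
  G.edist_triangle.trans (add_le_add (G.edist_triangle.trans (add_le_add hau huv)) hvb)

theorem exists_isBPrecoloring_of_pairwise_lt_edist [NeZero k] [Fintype V] [DecidableRel G.Adj]
    (hhigh : (Finset.univ.filter fun v => k ≤ G.degree v).card ≤ k) {x : Fin k → V}
    (hxdeg : ∀ i, G.degree (x i) + 1 = k) (hx : Pairwise fun i j => 3 < G.edist (x i) (x j))
    (hxhigh : ∀ v, k ≤ G.degree v → ∀ i, 2 < G.edist v (x i)) :
    ∃ C : Fin k → Set V, IsBPrecoloring G C := by
  classical
  have hball_card : ∀ i, (closedBall G (x i) 1).card = k := fun i => by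
    rw [closedBall_one, Finset.card_insert_of_notMem (G.notMem_neighborFinset_self _),
      card_neighborFinset_eq_degree, hxdeg]
  obtain ⟨g, hg, -⟩ := exists_injOn_apply_eq (s := Finset.univ.filter fun v => k ≤ G.degree v)
    (β := Fin k) (hhigh.trans_eq (Fintype.card_fin k).symm) (x 0) 0
  choose f hf hfx using fun i => exists_injOn_apply_eq
    ((hball_card i).trans (Fintype.card_fin k).symm).le (x i) i
  have hhigh_ball : ∀ {i u v}, k ≤ G.degree u → G.edist (x i) v ≤ 1 → ¬ G.edist u v ≤ 1 :=
    fun {i u v} hu hv huv => (hxhigh u hu i).not_ge <| by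
      simpa [one_add_one_eq_two] using
        edist_le_add_add edist_self.le huv (edist_comm.trans_le hv)
  have hball_ball : ∀ {i j u v}, G.edist (x i) u ≤ 1 → G.edist (x j) v ≤ 1 → G.edist u v ≤ 1 →
      i = j := fun {i j u v} hu hv huv => by
    by_contra hij
    exact (hx hij).not_ge (edist_le_add_add hu huv (edist_comm.trans_le hv))
  refine ⟨_, isBPrecoloring_of_separated_blocks
    (B := fun b : Option (Fin k) =>
      b.elim {v | k ≤ G.degree v} fun i => closedBall G (x i) 1)
    (f := fun b => b.elim g f) ?_ ?_ ?_ ?_⟩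
  · rintro (_ | i)
    exacts [by simpa using hg, hf i]
  · rintro (_ | i) (_ | j) u v hu hv huv
    · rfl
    · exact (hhigh_ball hu (mem_closedBall.1 hv) huv).elim
    · exact (hhigh_ball hv (mem_closedBall.1 hu) (edist_comm.trans_le huv)).elim
    · exact congrArg some (hball_ball (mem_closedBall.1 hu) (mem_closedBall.1 hv) huv)
  · refine fun i => ⟨some i, x i, mem_closedBall.2 (by simp), hfx i, fun j hj => ?_⟩
    obtain ⟨u, hu, huj⟩ := Finset.surjOn_of_injOn_of_card_le (t := Finset.univ) (f i)
      (by simp) (hf i) (by simp [hball_card]) (Finset.mem_coe.2 (Finset.mem_univ j))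
    have hux : u ≠ x i := fun h => hj (by rw [← huj, h]; exact hfx i)
    refine ⟨u, hu, huj, (G.mem_neighborFinset _ _).1 (Finset.mem_of_mem_insert_of_ne ?_ hux)⟩
    rwa [← closedBall_one]
  · exact fun v hv => ⟨none, hv⟩

theorem exists_pairwise_lt_edist_of_card [Fintype V] [DecidableRel G.Adj]
    (hΔ : ∀ v, G.degree v ≤ Δ)
    (hhigh : (Finset.univ.filter fun v => k ≤ G.degree v).card ≤ k)
    (hcard : 2 * (Δ + 1) ^ 4 ≤ (Finset.univ.filter fun v => k ≤ G.degree v + 1).card) :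
    ∃ x : Fin k → V, (∀ i, G.degree (x i) + 1 = k) ∧
      (Pairwise fun i j => 3 < G.edist (x i) (x j)) ∧
      ∀ v, k ≤ G.degree v → ∀ i, 2 < G.edist v (x i) := by
  classical
  let high : Finset V := Finset.univ.filter fun v => k ≤ G.degree v
  let near : Finset V := high.biUnion fun v => closedBall G v 2
  let D : Finset V := Finset.univ.filter fun v => k ≤ G.degree v + 1
  have hkΔ : k ≤ Δ + 1 := by
    obtain ⟨v, hv⟩ : D.Nonempty := Finset.card_pos.1 (lt_of_lt_of_le (by positivity) hcard)
    exact (Finset.mem_filter.1 hv).2.trans (Nat.succ_le_succ (hΔ v))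
  have hnear : near.card ≤ (Δ + 1) ^ 4 :=
    calc near.card ≤ high.card * (Δ + 1) ^ 2 := card_biUnion_closedBall_le hΔ high 2
      _ ≤ (Δ + 1) * (Δ + 1) ^ 2 := Nat.mul_le_mul_right _ (hhigh.trans hkΔ)
      _ = (Δ + 1) ^ 3 := (pow_succ' _ _).symm
      _ ≤ (Δ + 1) ^ 4 := Nat.pow_le_pow_right Δ.succ_pos (by norm_num)
  have hD : k * (Δ + 1) ^ 3 ≤ (D \ near).card :=
    calc k * (Δ + 1) ^ 3 ≤ (Δ + 1) * (Δ + 1) ^ 3 := Nat.mul_le_mul_right _ hkΔ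
      _ = (Δ + 1) ^ 4 := (pow_succ' _ _).symm
      _ ≤ D.card - near.card := Nat.le_sub_of_add_le <|
        (Nat.add_le_add_left hnear _).trans ((two_mul _).symm.trans_le hcard)
      _ ≤ (D \ near).card := Finset.le_card_sdiff _ _
  obtain ⟨X, hXD, hXk, hX⟩ := exists_subset_pairwise_lt_edist hΔ 3 hD
  let x := X.equivFinOfCardEq hXk
  have hxD : ∀ i, (x.symm i : V) ∈ D ∧ (x.symm i : V) ∉ near := fun i =>
    Finset.mem_sdiff.1 (hXD (x.symm i).2)
  have hfar : ∀ v, k ≤ G.degree v → ∀ i, 2 < G.edist v (x.symm i) := fun v hv i => by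
    refine not_le.1 fun h => (hxD i).2 (Finset.mem_biUnion.2 ⟨v, ?_, mem_closedBall.2 h⟩)
    exact Finset.mem_filter.2 ⟨Finset.mem_univ v, hv⟩
  refine ⟨fun i => x.symm i, fun i => ?_, fun i j hij => ?_, hfar⟩
  · have hlow : ¬ k ≤ G.degree (x.symm i : V) := fun h => by simpa using hfar _ h i
    exact le_antisymm (Nat.succ_le_of_lt (not_le.1 hlow)) (Finset.mem_filter.1 (hxD i).1).2
  · exact hX (x.symm i).2 (x.symm j).2 fun h => hij (x.symm.injective (Subtype.ext h))

theorem hasBColoring_of_card [Fintype V] [DecidableRel G.Adj] (hΔ : ∀ v, G.degree v ≤ Δ)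
    (hhigh : (Finset.univ.filter fun v => k ≤ G.degree v).card ≤ k)
    (hcard : 2 * (Δ + 1) ^ 4 ≤ (Finset.univ.filter fun v => k ≤ G.degree v + 1).card) :
    HasBColoring G k := by
  have hk : NeZero k := ⟨by
    rintro rfl
    have hpos : 0 < 2 * (Δ + 1) ^ 4 := by positivity
    simp only [Nat.zero_le, Finset.filter_true] at hhigh hcard
    omega⟩
  obtain ⟨x, hxdeg, hx, hxhigh⟩ := exists_pairwise_lt_edist_of_card hΔ hhigh hcard
  obtain ⟨C, hC⟩ := exists_isBPrecoloring_of_pairwise_lt_edist hhigh hxdeg hx hxhigh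
  exact hC.hasBColoring

end

/-! ### The m-degree -/

section

variable {V : Type*} [Fintype V] (G : SimpleGraph V)

theorem numDegGe_eq_card [DecidableRel G.Adj] (i : ℕ) :
    numDegGe G i = (Finset.univ.filter fun v => i ≤ G.degree v + 1).card := by
  unfold numDegGe
  congr!

theorem degree_le_maxDeg [DecidableRel G.Adj] (v : V) : G.degree v ≤ maxDeg G := by
  unfold maxDeg
  convert G.degree_le_maxDegree v

theorem card_mDegree_le_degree_le [DecidableRel G.Adj] :
    (Finset.univ.filter fun v => mDegree G ≤ G.degree v).card ≤ mDegree G := by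
  by_contra! hlt
  have hmem : mDegree G + 1 ∈ {i | i ≤ numDegGe G i} := by
    simpa [numDegGe_eq_card] using hlt
  exact Nat.not_succ_le_self _ ((isGreatest_mDegree G).2 hmem)

theorem mDegree_le_maxDeg_add_one : mDegree G ≤ maxDeg G + 1 := by
  classical
  rcases (mDegree G).eq_zero_or_pos with hzero | hpos
  · omega
  · have hcard := hpos.trans_le (isGreatest_mDegree G).1
    rw [numDegGe_eq_card, Finset.card_pos] at hcard
    obtain ⟨v, hv⟩ := hcard
    exact (Finset.mem_filter.1 hv).2.trans (Nat.succ_le_succ (degree_le_maxDeg G v))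

end

end BCol

namespace BCol

/-! ### The algorithm as a function of the adjacency matrix -/

namespace AdjArray

section

variable (A : ℕ → ℕ) (n : ℕ)

/-- Adjacency in the graph with vertex set `{0, …, n - 1}` whose adjacency matrix is stored row by
row in the array `A`. -/
def Adj (u v : ℕ) : Prop := 0 < A (u * n + v)

open Classical in
/-- The degree of `v` in the graph with adjacency matrix `A`. -/
noncomputable def degree (v : ℕ) : ℕ := Nat.count (Adj A n v) n

open Classical in
/-- The number of vertices of degree at least `i - 1` in the graph with adjacency matrix `A`. -/
noncomputable def numDegGe (i : ℕ) : ℕ := Nat.count (fun v => i ≤ degree A n v + 1) n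

open Classical in
/-- The m-degree of the graph with adjacency matrix `A`. Since the positive numbers `i` with at
least `i` vertices of degree at least `i - 1` are `1, …, m(G)`, it suffices to count them. -/
noncomputable def mDegree : ℕ := Nat.count (fun i => i + 1 ≤ numDegGe A n (i + 1)) n

open Classical in
/-- The maximum degree of the graph with adjacency matrix `A`, as the number of those `i` that are
smaller than some degree. -/
noncomputable def maxDeg : ℕ := Nat.count (fun i => ∃ v < n, i < degree A n v) n

/-- The vertices that are listed in certificates: those at distance at most one from a vertex of
degree at least `m(G) - 1`. -/
def IsCandidate (v : ℕ) : Prop :=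
  mDegree A n ≤ degree A n v + 1 ∨ ∃ u < n, Adj A n v u ∧ mDegree A n ≤ degree A n u + 1

open Classical in
/-- The number of candidates before `v`, by which the candidate `v` is represented in certificates.
The number of all candidates is `rank A n n`. -/
noncomputable def rank (v : ℕ) : ℕ := Nat.count (IsCandidate A n) v

/-- The `j`-th entry of the certificate `t`: the certificate encodes a list of candidates by its
digits, to the base given by the number of candidates. -/
noncomputable def digit (t j : ℕ) : ℕ := t / rank A n n ^ j % rank A n n

/-- The certificate `t` gives the color `j` to the vertex `v`. The certificate consists of `2 m(G)`
rows of length `m(G)`, and the vertices of color `j` are those in column `j`. -/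
def HasColor (t v j : ℕ) : Prop :=
  IsCandidate A n v ∧ ∃ i < 2 * mDegree A n, digit A n t (i * mDegree A n + j) = rank A n v

/-- The certificate `t` encodes a precoloring that extends to a b-coloring with `m(G)` colors. -/
def IsCertificate (t : ℕ) : Prop :=
  (∀ v < n, ∀ i < mDegree A n, ∀ j < mDegree A n,
    HasColor A n t v i → HasColor A n t v j → i = j) ∧
  (∀ j < mDegree A n, ∀ u < n, ∀ v < n,
    HasColor A n t u j → HasColor A n t v j → ¬ Adj A n u v) ∧
  (∀ i < mDegree A n, ∃ v < n, HasColor A n t v i ∧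
    ∀ j < mDegree A n, ¬ j = i → ∃ u < n, HasColor A n t u j ∧ Adj A n v u) ∧
  ∀ v < n, mDegree A n ≤ degree A n v → ∃ j < mDegree A n, HasColor A n t v j

/-- The answer of the algorithm: yes if many vertices have degree at least `m(G) - 1`, or if one of
the numbers below `P` is a certificate. -/
def Accepts (P : ℕ) : Prop :=
  2 * (maxDeg A n + 1) ^ 4 ≤ numDegGe A n (mDegree A n) ∨ ∃ t < P, IsCertificate A n t

/-- The binary logarithm of the number of certificates that the algorithm tries. -/
noncomputable def numBits : ℕ := 12 * (maxDeg A n + 1) * mDegree A n ^ 2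

end

section

variable {Γ : Type} [Context Γ] {n P t u v i j : (ℕ → ℕ) → Γ → ℕ}

theorem polyTimePred_adj (hn : PolyTime n) (hu : PolyTime u) (hv : PolyTime v) :
    PolyTimePred fun A γ => Adj A (n A γ) (u A γ) (v A γ) :=
  .lt (.const 0) ((hu.mul hn).add hv).arr

theorem polyTime_degree (hn : PolyTime n) (hv : PolyTime v) :
    PolyTime fun A γ => degree A (n A γ) (v A γ) := by
  classical
  exact hn.count (polyTimePred_adj hn.weaken hv.weaken .snd)

theorem polyTime_numDegGe (hn : PolyTime n) (hi : PolyTime i) :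
    PolyTime fun A γ => numDegGe A (n A γ) (i A γ) :=
  hn.count (P := fun A γ v => i A γ ≤ degree A (n A γ) v + 1)
    (.le hi.weaken ((polyTime_degree hn.weaken .snd).add (.const 1)))

theorem polyTime_mDegree (hn : PolyTime n) : PolyTime fun A γ => mDegree A (n A γ) :=
  have hsucc := PolyTime.snd.add (.const 1)
  hn.count (P := fun A γ i => i + 1 ≤ numDegGe A (n A γ) (i + 1))
    (.le hsucc (polyTime_numDegGe hn.weaken hsucc))

theorem polyTime_maxDeg (hn : PolyTime n) : PolyTime fun A γ => maxDeg A (n A γ) :=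
  hn.count (P := fun A γ i => ∃ v < n A γ, i < degree A (n A γ) v) <|
    .exists_lt (P := fun A x v => x.2 < degree A (n A x.1) v) hn.weaken
      (.lt PolyTime.snd.weaken (polyTime_degree hn.weaken.weaken .snd))

theorem polyTimePred_isCandidate (hn : PolyTime n) (hv : PolyTime v) :
    PolyTimePred fun A γ => IsCandidate A (n A γ) (v A γ) :=
  have hm := polyTime_mDegree hn
  .or (.le hm ((polyTime_degree hn hv).add (.const 1))) <|
    .exists_lt (P := fun A γ u =>
      Adj A (n A γ) (v A γ) u ∧ mDegree A (n A γ) ≤ degree A (n A γ) u + 1) hn <|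
      .and (polyTimePred_adj hn.weaken hv.weaken .snd)
        (.le hm.weaken ((polyTime_degree hn.weaken .snd).add (.const 1)))

theorem polyTime_rank (hn : PolyTime n) (hv : PolyTime v) :
    PolyTime fun A γ => rank A (n A γ) (v A γ) := by
  classical
  exact hv.count (polyTimePred_isCandidate hn.weaken .snd)

theorem polyTime_digit (hn : PolyTime n) (ht : PolyTime t) (hj : PolyTime j) :
    PolyTime fun A γ => digit A (n A γ) (t A γ) (j A γ) :=
  have hbase := polyTime_rank hn hn
  (ht.div_pow hbase hj).mod hbase

theorem polyTimePred_hasColor (hn : PolyTime n) (ht : PolyTime t) (hv : PolyTime v)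
    (hj : PolyTime j) : PolyTimePred fun A γ => HasColor A (n A γ) (t A γ) (v A γ) (j A γ) :=
  have hm := polyTime_mDegree hn
  .and (polyTimePred_isCandidate hn hv) <|
    .exists_lt (P := fun A γ i =>
      digit A (n A γ) (t A γ) (i * mDegree A (n A γ) + j A γ) = rank A (n A γ) (v A γ))
      (.mul (.const 2) hm) <|
      .eq (polyTime_digit hn.weaken ht.weaken ((PolyTime.snd.mul hm.weaken).add hj.weaken))
        (polyTime_rank hn hv).weaken

theorem polyTimePred_isCertificate (hn : PolyTime n) (ht : PolyTime t) :
    PolyTimePred fun A γ => IsCertificate A (n A γ) (t A γ) := by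
  have hn₁ := hn.weaken
  have hn₂ := hn₁.weaken
  have hn₃ := hn₂.weaken
  have ht₂ := ht.weaken.weaken
  have ht₃ := ht₂.weaken
  refine .and (.forall_lt hn ?_) <| .and (.forall_lt (polyTime_mDegree hn) ?_) <|
    .and (.forall_lt (polyTime_mDegree hn) ?_) (.forall_lt hn ?_)
  · refine .forall_lt (polyTime_mDegree hn₁) <| .forall_lt (polyTime_mDegree hn₂) ?_
    exact (polyTimePred_hasColor hn₃ ht₃ PolyTime.snd.weaken.weaken PolyTime.snd.weaken).imp <|
      (polyTimePred_hasColor hn₃ ht₃ PolyTime.snd.weaken.weaken .snd).imp <|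
        .eq PolyTime.snd.weaken .snd
  · refine .forall_lt hn₁ <| .forall_lt hn₂ ?_
    exact (polyTimePred_hasColor hn₃ ht₃ PolyTime.snd.weaken PolyTime.snd.weaken.weaken).imp <|
      (polyTimePred_hasColor hn₃ ht₃ .snd PolyTime.snd.weaken.weaken).imp <|
        (polyTimePred_adj hn₃ PolyTime.snd.weaken .snd).not
  · refine .exists_lt hn₁ <| .and (polyTimePred_hasColor hn₂ ht₂ .snd PolyTime.snd.weaken) <|
      .forall_lt (polyTime_mDegree hn₂) <|
        .imp (PolyTimePred.eq .snd PolyTime.snd.weaken.weaken).not <| .exists_lt hn₃ ?_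
    exact (polyTimePred_hasColor hn₃.weaken ht₃.weaken .snd PolyTime.snd.weaken).and
      (polyTimePred_adj hn₃.weaken PolyTime.snd.weaken.weaken .snd)
  · exact .imp (.le (polyTime_mDegree hn₁) (polyTime_degree hn₁ .snd)) <|
      .exists_lt (polyTime_mDegree hn₁) <|
        polyTimePred_hasColor hn₂ ht₂ PolyTime.snd.weaken .snd

theorem polyTimePred_accepts (hn : PolyTime n) (hP : PolyTime P) :
    PolyTimePred fun A γ => Accepts A (n A γ) (P A γ) :=
  .or (.le (.mul (.const 2) (((polyTime_maxDeg hn).add (.const 1)).pow 4))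
    (polyTime_numDegGe hn (polyTime_mDegree hn))) <|
    .exists_lt hP (polyTimePred_isCertificate hn.weaken .snd)

theorem polyTime_numBits (hn : PolyTime n) : PolyTime fun A γ => numBits A (n A γ) :=
  .mul (.mul (.const 12) ((polyTime_maxDeg hn).add (.const 1))) ((polyTime_mDegree hn).pow 2)

end

end AdjArray

end BCol

namespace BCol

/-! ### Correctness of the algorithm -/

theorem count_eq_card_filter_univ_fin (p : ℕ → Prop) [DecidablePred p] (n : ℕ) :
    Nat.count p n = (Finset.univ.filter fun v : Fin n => p v).card := by
  rw [Nat.count_eq_card_filter_range, Finset.card_filter, Finset.card_filter, Finset.sum_range]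

theorem count_eq_of_forall_lt_iff {p : ℕ → Prop} [DecidablePred p] {m n : ℕ}
    (h : ∀ i, i < n ∧ p i ↔ i < m) : Nat.count p n = m := by
  have hfilter : (Finset.range n).filter p = Finset.range m := by
    ext i
    simp only [Finset.mem_filter, Finset.mem_range, h]
  rw [Nat.count_eq_card_filter_range, hfilter, Finset.card_range]

theorem exists_forall_div_pow_mod_eq {B L : ℕ} (f : Fin L → Fin B) :
    ∃ t < B ^ L, ∀ j : Fin L, t / B ^ (j : ℕ) % B = f j :=
  ⟨finFunctionFinEquiv f, (finFunctionFinEquiv f).2, fun j => by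
    rw [← finFunctionFinEquiv_symm_apply_val, Equiv.symm_apply_apply]⟩

theorem exists_range_eq_of_card_le {α : Type*} {s : Finset α} {m : ℕ} (hs : s.Nonempty)
    (hm : s.card ≤ m) : ∃ f : Fin m → α, Set.range f = s := by
  have : Nonempty s := hs.to_subtype
  obtain ⟨e⟩ : Nonempty (s ↪ Fin m) := Function.Embedding.nonempty_of_card_le (by simpa using hm)
  refine ⟨fun i => ((Function.invFun e i : s) : α), ?_⟩
  rw [Set.range_comp' Subtype.val, (Function.invFun_surjective e.injective).range_eq]
  simp

theorem two_mul_pow_five_le_two_pow (m : ℕ) : 2 * m ^ 5 ≤ 2 ^ (6 * m) := by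
  rcases m.eq_zero_or_pos with rfl | hm
  · simp
  · calc 2 * m ^ 5 ≤ 2 ^ m * (2 ^ m) ^ 5 := by
          gcongr
          · exact le_self_pow₀ one_le_two hm.ne'
          · exact Nat.lt_two_pow_self.le
      _ = 2 ^ (6 * m) := by ring

section

variable {n : ℕ} (G : SimpleGraph (Fin n))

/-- The adjacency matrix of `G` as it is stored in the memory of the machine. -/
noncomputable def adjArray : ℕ → ℕ := (inputState G).arr 0

theorem adjArray_le_one (i : ℕ) : adjArray G i ≤ 1 := by
  unfold adjArray inputState
  dsimp only
  split_ifs <;> simp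

theorem adj_adjArray (u v : Fin n) : AdjArray.Adj (adjArray G) n u v ↔ G.Adj u v := by
  unfold AdjArray.Adj adjArray inputState
  have hindex : ∀ u' v' : Fin n, (u : ℕ) * n + v = u' * n + v' ↔ (u, v) = (u', v') := by
    intro u' v'
    rw [← finProdFinEquiv.apply_eq_iff_eq, Fin.ext_iff]
    simp only [finProdFinEquiv_apply_val, mul_comm, add_comm]
  have hiff : (0 = 0 ∧ ∃ u' v' : Fin n, (u : ℕ) * n + v = u' * n + v' ∧ G.Adj u' v') ↔
      G.Adj u v := by
    simp [hindex]
  dsimp only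
  split_ifs with hadj
  · simpa using hiff.1 hadj
  · simpa using mt hiff.2 hadj

theorem degree_adjArray [DecidableRel G.Adj] (v : Fin n) :
    AdjArray.degree (adjArray G) n v = G.degree v := by
  classical
  rw [AdjArray.degree, count_eq_card_filter_univ_fin, ← SimpleGraph.card_neighborFinset_eq_degree]
  simp only [adj_adjArray, SimpleGraph.neighborFinset_eq_filter]

theorem numDegGe_adjArray (i : ℕ) : AdjArray.numDegGe (adjArray G) n i = numDegGe G i := by
  classical
  rw [AdjArray.numDegGe, count_eq_card_filter_univ_fin, numDegGe_eq_card]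
  simp only [degree_adjArray]

theorem mDegree_adjArray : AdjArray.mDegree (adjArray G) n = mDegree G := by
  classical
  refine count_eq_of_forall_lt_iff fun i => ?_
  rw [numDegGe_adjArray]
  refine ⟨fun h => (isGreatest_mDegree G).2 h.2, fun h => ?_⟩
  have hm : mDegree G ≤ numDegGe G (mDegree G) := (isGreatest_mDegree G).1
  have hanti : numDegGe G (mDegree G) ≤ numDegGe G (i + 1) :=
    Finset.card_le_card (Finset.monotone_filter_right _ fun v _ => (Nat.succ_le_of_lt h).trans)
  have hn : numDegGe G (mDegree G) ≤ n :=
    (Finset.card_le_univ _).trans_eq (Fintype.card_fin n)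
  omega

theorem maxDeg_adjArray : AdjArray.maxDeg (adjArray G) n = maxDeg G := by
  classical
  refine count_eq_of_forall_lt_iff fun i => ?_
  constructor
  · rintro ⟨-, v, hv, hi⟩
    rw [degree_adjArray G ⟨v, hv⟩] at hi
    exact hi.trans_le (degree_le_maxDeg G _)
  · intro hi
    obtain ⟨v, hv⟩ : ∃ v, i < G.degree v := by
      by_contra! hle
      exact (G.maxDegree_le_of_forall_degree_le i hle).not_gt (by unfold maxDeg at hi; convert hi)
    exact ⟨hv.trans ((G.degree_lt_card_verts v).trans_eq (Fintype.card_fin n)), v, v.2,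
      hv.trans_eq (degree_adjArray G v).symm⟩

theorem isCandidate_adjArray [DecidableRel G.Adj] (v : Fin n) :
    AdjArray.IsCandidate (adjArray G) n v ↔ IsCandidate G (mDegree G) v := by
  unfold AdjArray.IsCandidate IsCandidate
  rw [mDegree_adjArray]
  simp only [← adj_adjArray, ← degree_adjArray, Fin.exists_iff, exists_prop]

theorem isCertificate_adjArray [DecidableRel G.Adj] (t : ℕ) :
    AdjArray.IsCertificate (adjArray G) n t ↔ IsBPrecoloring G fun j : Fin (mDegree G) =>
      {v : Fin n | AdjArray.HasColor (adjArray G) n t v j} := by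
  have hiff : ∀ C : Fin (mDegree G) → Set (Fin n), IsBPrecoloring G C ↔
      (∀ v i j, v ∈ C i → v ∈ C j → i = j) ∧ (∀ j u v, u ∈ C j → v ∈ C j → ¬ G.Adj u v) ∧
      (∀ i, ∃ v ∈ C i, ∀ j, j ≠ i → ∃ u ∈ C j, G.Adj v u) ∧
      ∀ v, mDegree G ≤ G.degree v → ∃ j, v ∈ C j := fun C =>
    ⟨fun h => ⟨h.1, h.2, h.3, h.4⟩, fun h => ⟨h.1, h.2.1, h.2.2.1, h.2.2.2⟩⟩
  rw [hiff, AdjArray.IsCertificate, mDegree_adjArray]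
  simp only [← adj_adjArray, ← degree_adjArray, Fin.forall_iff, Fin.exists_iff, Fin.ext_iff,
    Set.mem_ofPred_eq, ne_eq, exists_prop]

theorem rank_adjArray_lt {v : ℕ} (hvn : v < n) (hv : AdjArray.IsCandidate (adjArray G) n v) :
    AdjArray.rank (adjArray G) n v < AdjArray.rank (adjArray G) n n := by
  classical exact Nat.count_strict_mono hv hvn

theorem rank_adjArray_le (h : numDegGe G (mDegree G) ≤ 2 * (maxDeg G + 1) ^ 4) :
    AdjArray.rank (adjArray G) n n ≤ 2 ^ (6 * (maxDeg G + 1)) := by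
  classical
  let D : Finset (Fin n) := Finset.univ.filter fun v => mDegree G ≤ G.degree v + 1
  have hsub : (Finset.univ.filter fun v : Fin n => AdjArray.IsCandidate (adjArray G) n v) ⊆
      D.biUnion fun v => closedBall G v 1 := by
    intro v hv
    simp only [Finset.mem_filter, Finset.mem_univ, true_and, isCandidate_adjArray] at hv
    simp only [D, Finset.mem_biUnion, Finset.mem_filter, Finset.mem_univ, true_and,
      closedBall_one, Finset.mem_insert, SimpleGraph.mem_neighborFinset]
    rcases hv with hv | ⟨u, hvu, hu⟩
    exacts [⟨v, hv, Or.inl rfl⟩, ⟨u, hu, Or.inr hvu.symm⟩]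
  rw [AdjArray.rank, count_eq_card_filter_univ_fin]
  calc (Finset.univ.filter fun v : Fin n => AdjArray.IsCandidate (adjArray G) n v).card
      ≤ D.card * (maxDeg G + 1) ^ 1 :=
        (Finset.card_le_card hsub).trans (card_biUnion_closedBall_le (degree_le_maxDeg G) D 1)
    _ ≤ 2 * (maxDeg G + 1) ^ 4 * (maxDeg G + 1) := by
        rw [pow_one]
        exact Nat.mul_le_mul_right _ ((numDegGe_eq_card G _).ge.trans h)
    _ = 2 * (maxDeg G + 1) ^ 5 := by ring
    _ ≤ 2 ^ (6 * (maxDeg G + 1)) := two_mul_pow_five_le_two_pow _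

theorem exists_isCertificate (h : HasBColoring G (mDegree G)) :
    ∃ t < AdjArray.rank (adjArray G) n n ^ (2 * mDegree G * mDegree G),
      AdjArray.IsCertificate (adjArray G) n t := by
  classical
  obtain ⟨W, hW, hC⟩ := h.exists_isBPrecoloring (card_mDegree_le_degree_le G)
  choose w hw using fun j => exists_range_eq_of_card_le (hW j).1 (hW j).2.1
  have hcand : ∀ j i, AdjArray.IsCandidate (adjArray G) n (w j i) := fun j i =>
    (isCandidate_adjArray G _).2 <| (hW j).2.2 _ <| by
      rw [← Finset.mem_coe, ← hw]
      exact Set.mem_range_self i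
  obtain ⟨t, ht, hdigit⟩ := exists_forall_div_pow_mod_eq fun x =>
    (⟨_, rank_adjArray_lt G (Fin.is_lt _)
      (hcand (finProdFinEquiv.symm x).2 (finProdFinEquiv.symm x).1)⟩ :
      Fin (AdjArray.rank (adjArray G) n n))
  refine ⟨t, ht, (isCertificate_adjArray G t).2 ?_⟩
  convert hC using 2 with j
  ext v
  rw [Set.mem_ofPred_eq, ← hw, AdjArray.HasColor, mDegree_adjArray]
  have hentry : ∀ i : Fin (2 * mDegree G),
      AdjArray.digit (adjArray G) n t (i * mDegree G + j) =
        AdjArray.rank (adjArray G) n (w j i) := fun i => by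
    simpa [AdjArray.digit, add_comm, mul_comm] using hdigit (finProdFinEquiv (i, j))
  constructor
  · rintro ⟨hv, i, hi, heq⟩
    rw [hentry ⟨i, hi⟩] at heq
    exact ⟨⟨i, hi⟩, Fin.ext (Nat.count_injective (hcand _ _) hv heq)⟩
  · rintro ⟨i, rfl⟩
    exact ⟨hcand j i, i, i.2, hentry i⟩

theorem accepts_adjArray :
    AdjArray.Accepts (adjArray G) n (2 ^ AdjArray.numBits (adjArray G) n) ↔
      HasBColoring G (mDegree G) := by
  classical
  rw [AdjArray.Accepts, AdjArray.numBits, maxDeg_adjArray, mDegree_adjArray, numDegGe_adjArray]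
  refine ⟨?_, fun h => or_iff_not_imp_left.2 fun hcard => ?_⟩
  · rintro (hcard | ⟨t, -, ht⟩)
    · exact hasBColoring_of_card (degree_le_maxDeg G) (card_mDegree_le_degree_le G)
        (hcard.trans_eq (numDegGe_eq_card G _))
    · exact ((isCertificate_adjArray G t).1 ht).hasBColoring
  · obtain ⟨t, ht, hcert⟩ := exists_isCertificate G h
    refine ⟨t, ht.trans_le ?_, hcert⟩
    calc AdjArray.rank (adjArray G) n n ^ (2 * mDegree G * mDegree G)
        ≤ (2 ^ (6 * (maxDeg G + 1))) ^ (2 * mDegree G * mDegree G) :=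
          Nat.pow_le_pow_left (rank_adjArray_le G (not_le.1 hcard).le) _
      _ = 2 ^ (12 * (maxDeg G + 1) * mDegree G ^ 2) := by
        rw [← pow_mul]
        congr 1
        ring

end

end BCol

namespace BCol

open Polynomial

/-! ### Running time -/

/-- Writes `2 ^ e` into register `d + 1`, where `e` is the content of register `d`, by repeated
doubling. Register `d + 2` is the counter. -/
def Prog.twoPow (d : ℕ) : Prog :=
  .seq (.const (d + 1) 1) <| .seq (.const (d + 2) 0) <| .seq (.const (d + 3) 1) <|
    .loop (d + 2) d <| .seq (.add (d + 1) (d + 1) (d + 1)) (.add (d + 2) (d + 2) (d + 3))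

theorem HaltsWithin.twoPow (d : ℕ) (s : State) :
    HaltsWithin (.twoPow d) s (3 * s.reg d + 4)
      fun s' => s'.reg (d + 1) = 2 ^ s.reg d ∧ AgreeBelow (d + 1) s s' := by
  let I : ℕ → State → Prop := fun i s' =>
    s'.reg (d + 1) = 2 ^ i ∧ s'.reg (d + 2) = i ∧ s'.reg (d + 3) = 1 ∧ AgreeBelow (d + 1) s s'
  have hstep : ∀ i < s.reg d, ∀ s', I i s' → HaltsWithin
      (.seq (.add (d + 1) (d + 1) (d + 1)) (.add (d + 2) (d + 2) (d + 3))) s' 2 (I (i + 1)) :=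
    fun i _ s' ⟨hpow, hcounter, hone, hs'⟩ => .seq <| .add <| .add
      ⟨by simp [hpow, pow_succ, mul_two], by simp [hcounter, hone], by simp [hone],
        (hs'.setReg le_rfl).setReg (by omega)⟩
  have hinit : I 0 (((s.setReg (d + 1) 1).setReg (d + 2) 0).setReg (d + 3) 1) :=
    ⟨by simp, by simp, by simp, (((AgreeBelow.refl _ s).setReg le_rfl).setReg
      (by omega)).setReg (by omega)⟩
  refine (HaltsWithin.seq <| .const <| .seq <| .const <| .seq <| .const <| .countedLoop I
    (fun _ _ h => h.2.1) (fun _ _ h => h.2.2.2.2 d d.lt_succ_self) hstep hinit).mono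
    (by omega) fun s' hs' => ⟨hs'.1, hs'.2.2.2⟩

section

variable {n : ℕ} (G : SimpleGraph (Fin n))

theorem holds_inputState : Holds id (adjArray G) n (inputState G) :=
  ⟨rfl, fun i hi => by
    obtain rfl : i = 0 := Nat.lt_one_iff.1 hi
    rfl⟩

theorem boundedBy_adjArray {N : ℕ} (hN : 1 ≤ N) (hn : n ≤ N) : BoundedBy N (adjArray G) n :=
  ⟨fun i => (adjArray_le_one G i).trans hN, fun _ _ => hn⟩

end

theorem exists_decidesInTime_of_polyTime {e : (ℕ → ℕ) → ℕ → ℕ} {P : (ℕ → ℕ) → ℕ → ℕ → Prop}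
    (he : PolyTime e) (hP : PolyTimePred fun A (x : ℕ × ℕ) => P A x.1 x.2) :
    ∃ (p : Prog) (c : ℕ),
      DecidesInTime p (fun {n} G => P (adjArray G) n (2 ^ e (adjArray G) n))
        (fun {n} G => c * ((n + 2 ^ e (adjArray G) n) ^ c + 1)) := by
  classical
  obtain ⟨q₁, hq₁⟩ := he.eval
  obtain ⟨q₂, hq₂⟩ := (PolyTime.ite hP (.const 1) (.const 0)).eval
  have hπ : ∀ i < Context.size ℕ, id i < 1 := fun _ => id
  obtain ⟨p₁, hp₁⟩ := hq₁ id 1 hπ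
  obtain ⟨p₂, hp₂⟩ := hq₂ (Function.update id 1 2) 3
    (update_lt_of_forall_lt (fun i hi => (hπ i hi).trans (by omega)) (by omega))
  obtain ⟨c, hc⟩ := exists_eval_le_mul_pow_add_one (q₁ + 3 * X + q₂ + 6)
  refine ⟨.seq p₁ <| .seq (.twoPow 1) <| .seq p₂ <| .seq (.const 0 0) (.add 0 0 3), c,
    fun n G => ?_⟩
  set E := e (adjArray G) n
  have hE : E < 2 ^ E := Nat.lt_two_pow_self
  have hbounded : BoundedBy (n + 2 ^ E) (adjArray G) n := boundedBy_adjArray G (by omega) (by omega)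
  have hrun : HaltsWithin (.seq p₁ <| .seq (.twoPow 1) <| .seq p₂ <| .seq (.const 0 0)
      (.add 0 0 3)) (inputState G) (c * ((n + 2 ^ E) ^ c + 1))
      fun s => s.reg 0 = if P (adjArray G) n (2 ^ E) then 1 else 0 := by
    refine (HaltsWithin.seq <| (hp₁ _ _ _ _ hbounded (holds_inputState G) trivial).mono le_rfl
      fun s₁ ⟨hE₁, hs₁⟩ => .seq <| (HaltsWithin.twoPow 1 s₁).mono (by rw [hE₁])
        fun s₂ ⟨hpow, hs₂⟩ => .seq <| (hp₂ _ _ (n, 2 ^ E) s₂ (hbounded.prodMk (by omega))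
          ?_ trivial).mono le_rfl fun s₃ ⟨hres, _⟩ => .seq <| .const <| .add ?_).mono
      (le_trans ?_ (hc (n + 2 ^ E))) fun _ => id
    · exact (((holds_inputState G).of_agreeBelow hπ hs₁).of_agreeBelow hπ
        (hs₂.mono one_le_two)).prodMk (hpow.trans (by rw [hE₁]))
    · simp [hres]
    · simp only [eval_add, eval_mul, eval_X, eval_ofNat]
      omega
  obtain ⟨t, s, hs, ht, hres⟩ := hrun
  exact ⟨t, s, hs, ht, fun h => hres.trans (if_pos h), fun h => hres.trans (if_neg h)⟩

theorem exists_decidesInTime_hasBColoring_two_pow :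
    ∃ (p : Prog) (c : ℕ), DecidesInTime p (fun G => HasBColoring G (mDegree G))
      (fun {n} G => c * ((n + 2 ^ (12 * (maxDeg G + 1) * mDegree G ^ 2)) ^ c + 1)) := by
  have haccepts := exists_decidesInTime_of_polyTime (P := AdjArray.Accepts)
    (AdjArray.polyTime_numBits .nat) (AdjArray.polyTimePred_accepts PolyTime.nat.weaken .snd)
  simp only [accepts_adjArray] at haccepts
  simpa only [AdjArray.numBits, maxDeg_adjArray, mDegree_adjArray] using haccepts

theorem two_pow_add_mul_le (a b x : ℕ) : 2 ^ (a + b * x) ≤ 2 ^ ((a + b) * x) + 2 ^ a := by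
  rcases x.eq_zero_or_pos with rfl | hx
  · simp
  · have hexp : a + b * x ≤ (a + b) * x := by
      rw [add_mul]
      gcongr
      exact Nat.le_mul_of_pos_right a hx
    exact (Nat.pow_le_pow_right two_pos hexp).trans (Nat.le_add_right _ _)

theorem mul_add_two_pow_pow_le (c a b n x : ℕ) :
    c * ((n + 2 ^ (a + b * x)) ^ c + 1) ≤
      2 ^ ((c * 2 ^ c + a * c + b * c) * x) +
        (c * 2 ^ c + 2 ^ (c * 2 ^ c + a * c)) * (n ^ c + 1) := by
  have hpow : (n + 2 ^ (a + b * x)) ^ c ≤ 2 ^ c * (n ^ c + (2 ^ (a + b * x)) ^ c) :=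
    (add_pow_le (Nat.zero_le _) (Nat.zero_le _) c).trans
      (Nat.mul_le_mul_right _ (Nat.pow_le_pow_right two_pos (Nat.sub_le c 1)))
  set K := c * 2 ^ c
  calc c * ((n + 2 ^ (a + b * x)) ^ c + 1)
      ≤ c * (2 ^ c * (n ^ c + (2 ^ (a + b * x)) ^ c) + 2 ^ c) := by
        gcongr
        exact Nat.one_le_two_pow
    _ = K * 2 ^ (a * c + b * c * x) + K * (n ^ c + 1) := by ring
    _ ≤ 2 ^ K * 2 ^ (a * c + b * c * x) + K * (n ^ c + 1) := by
        gcongr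
        exact Nat.lt_two_pow_self.le
    _ = 2 ^ (K + a * c + b * c * x) + K * (n ^ c + 1) := by ring
    _ ≤ 2 ^ ((K + a * c + b * c) * x) + 2 ^ (K + a * c) * 1 + K * (n ^ c + 1) := by
        gcongr
        rw [mul_one]
        exact two_pow_add_mul_le _ _ _
    _ ≤ 2 ^ ((K + a * c + b * c) * x) + 2 ^ (K + a * c) * (n ^ c + 1) + K * (n ^ c + 1) := by
        gcongr
        exact Nat.le_add_left _ _
    _ = 2 ^ ((K + a * c + b * c) * x) + (K + 2 ^ (K + a * c)) * (n ^ c + 1) := by ring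

theorem mul_maxDeg_add_one_mul_mDegree_sq_le {V : Type*} [Fintype V] (G : SimpleGraph V) :
    12 * (maxDeg G + 1) * mDegree G ^ 2 ≤ 12 + 24 * (mDegree G ^ 4 * maxDeg G) := by
  rcases (maxDeg G).eq_zero_or_pos with hΔ | hΔ
  · have hk : mDegree G ^ 2 ≤ 1 :=
      pow_le_one₀ (Nat.zero_le _) ((mDegree_le_maxDeg_add_one G).trans_eq (by rw [hΔ, zero_add]))
    rw [hΔ]
    omega
  · calc 12 * (maxDeg G + 1) * mDegree G ^ 2
        ≤ 12 * (maxDeg G + maxDeg G) * (mDegree G ^ 2) ^ 2 := by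
          gcongr
          · exact hΔ
          · exact Nat.le_self_pow two_ne_zero _
      _ = 24 * (mDegree G ^ 4 * maxDeg G) := by ring
      _ ≤ 12 + 24 * (mDegree G ^ 4 * maxDeg G) := Nat.le_add_left _ _

namespace DecidesInTime

variable {p : Prog} {Q : ∀ {n : ℕ}, SimpleGraph (Fin n) → Prop} {c : ℕ}

theorem mono {T T' : ∀ {n : ℕ}, SimpleGraph (Fin n) → ℕ} (h : DecidesInTime p Q T)
    (hT : ∀ (n : ℕ) (G : SimpleGraph (Fin n)), T G ≤ T' G) : DecidesInTime p Q T' := by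
  intro n G
  obtain ⟨t, s, hrun, ht, hres⟩ := h n G
  exact ⟨t, s, hrun, ht.trans (hT n G), hres⟩

theorem of_mDegree (h : DecidesInTime p Q
      (fun {n} G => 2 ^ (c * (mDegree G ^ 4 * maxDeg G)) + c * (n ^ c + 1))) :
    DecidesInTime p Q
      (fun {n} G => 2 ^ (16 * c * maxDeg G ^ 5) + 16 * c * (n ^ (16 * c) + 1)) := by
  refine h.mono fun n G => add_le_add (Nat.pow_le_pow_right two_pos ?_)
    (mul_pow_add_one_le (by omega) (by omega) n)
  rcases (maxDeg G).eq_zero_or_pos with hΔ | hΔ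
  · simp [hΔ]
  · calc c * (mDegree G ^ 4 * maxDeg G) ≤ c * ((maxDeg G + maxDeg G) ^ 4 * maxDeg G) := by
          gcongr
          exact (mDegree_le_maxDeg_add_one G).trans (Nat.add_le_add_left hΔ _)
      _ = 16 * c * maxDeg G ^ 5 := by ring

theorem isFPT {κ : ∀ {n : ℕ}, SimpleGraph (Fin n) → ℕ} {g : ℕ → ℕ} (hg : Computable g)
    (h : DecidesInTime p Q (fun {n} G => g (κ G) + c * (n ^ c + 1))) : IsFPT Q κ := by
  refine ⟨p, fun d => g d + 2 * c, c,
    (Primrec.nat_add.to_comp).comp hg (.const (2 * c)), h.mono fun n G => ?_⟩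
  have hn : n ≤ n ^ 2 + 1 := (Nat.le_self_pow two_ne_zero n).trans (Nat.le_succ _)
  calc g (κ G) + c * (n ^ c + 1)
      ≤ g (κ G) * (n ^ 2 + 1) ^ c + c * ((n ^ 2 + 1) ^ c + (n ^ 2 + 1) ^ c) := by
        gcongr
        · exact Nat.le_mul_of_pos_right _ (by positivity)
        · exact Nat.one_le_pow _ _ (Nat.succ_pos _)
    _ = (g (κ G) + 2 * c) * inputSize G ^ c := by
        rw [inputSize]
        ring

end DecidesInTime

theorem computable_two_pow_mul_pow (c m : ℕ) : Computable fun d : ℕ => 2 ^ (c * d ^ m) := by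
  have hpow : Primrec₂ fun a b : ℕ => a ^ b := Primrec₂.unpaired'.1 Nat.Primrec.pow
  exact (hpow.comp (.const 2) (Primrec.nat_mul.comp (.const c) (hpow.comp .id (.const m)))).to_comp

theorem exists_decidesInTime_hasBColoring :
    ∃ (p : Prog) (c : ℕ), DecidesInTime p (fun G => HasBColoring G (mDegree G))
      (fun {n} G => 2 ^ (c * (mDegree G ^ 4 * maxDeg G)) + c * (n ^ c + 1)) := by
  obtain ⟨p, c, h⟩ := exists_decidesInTime_hasBColoring_two_pow
  set a := c * 2 ^ c + 12 * c
  refine ⟨p, 2 * (c * 2 ^ c + 2 ^ a) + (a + 24 * c), h.mono fun n G => ?_⟩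
  calc c * ((n + 2 ^ (12 * (maxDeg G + 1) * mDegree G ^ 2)) ^ c + 1)
      ≤ c * ((n + 2 ^ (12 + 24 * (mDegree G ^ 4 * maxDeg G))) ^ c + 1) := by
        gcongr
        · exact one_le_two
        · exact mul_maxDeg_add_one_mul_mDegree_sq_le G
    _ ≤ 2 ^ ((a + 24 * c) * (mDegree G ^ 4 * maxDeg G)) + (c * 2 ^ c + 2 ^ a) * (n ^ c + 1) :=
        mul_add_two_pow_pow_le _ _ _ _ _
    _ ≤ _ := by
        refine add_le_add (Nat.pow_le_pow_right two_pos (Nat.mul_le_mul_right _ ?_))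
          (mul_pow_add_one_le (by omega) (by omega) n)
        exact Nat.le_add_left _ _

end BCol

theorem mainTheorem8 :
    (∃ p : BCol.Prog,
      (∃ c : ℕ, BCol.DecidesInTime p (fun G => BCol.HasBColoring G (BCol.mDegree G))
        (fun {n} G => 2 ^ (c * (BCol.mDegree G ^ 4 * BCol.maxDeg G)) + c * (n ^ c + 1))) ∧
      (∃ c : ℕ, BCol.DecidesInTime p (fun G => BCol.HasBColoring G (BCol.mDegree G))
        (fun {n} G => 2 ^ (c * BCol.maxDeg G ^ 5) + c * (n ^ c + 1)))) ∧
    BCol.IsFPT (fun G => BCol.HasBColoring G (BCol.mDegree G)) (fun G => BCol.maxDeg G) := by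
  obtain ⟨p, c, hmDegree⟩ := BCol.exists_decidesInTime_hasBColoring
  have hmaxDeg := hmDegree.of_mDegree
  exact ⟨⟨p, ⟨c, hmDegree⟩, 16 * c, hmaxDeg⟩,
    hmaxDeg.isFPT (BCol.computable_two_pow_mul_pow (16 * c) 5)⟩
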